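/- Let $E$ be a second countable locally compact Hausdorff groupoid with unit space $E^{(0)}$, range and source maps $r,s$, and a Haar system. Assume that $E$ is principal (if $r(\gamma)=s(\gamma)$ then $\gamma$ is a unit) and proper (for all compact $K,L\subseteq E^{(0)}$ the set $\{\gamma\in E: s(\gamma)\in K,\ r(\gamma)\in L\}$ is compact). For $u\in E^{(0)}$ let $E\cdot u=\{r(\gamma): s(\gamma)=u\}$ be its orbit, let $E\backslash E^{(0)}$ be the orbit space with the quotient topology, and let $E|_{E\cdot u}=\{\gamma: r(\gamma),s(\gamma)\in E\cdot u\}$. Let $\mathscr{A}$ be an upper semicontinuous $C^*$-bundle over $E^{(0)}$ with fibres $A(u)$, whose section algebra $A=\Gamma_0(E^{(0)},\mathscr{A})$ is separable, and let $\alpha$ be an action of $E$ on $\mathscr A$, that is, a family of (norm preserving) $*$-isomorphisms $\alpha_\gamma:A(s(\gamma))\to A(r(\gamma))$ such that $\alpha_\gamma\alpha_\eta=\alpha_{\gamma\eta}$ whenever $s(\gamma)=r(\eta)$ and such that $(\gamma,a)\mapsto\alpha_\gamma(a)$ is continuous. The induced algebra $\mathrm{Ind}_{E^{(0)}}^{E}(A,\alpha)$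 consists of all bounded continuous sections $f$ of $\mathscr{A}$ such that $f(r(\gamma))=\alpha_\gamma(f(s(\gamma)))$ for all $\gamma\in E$ and such that $E\cdot u\mapsto\|f(u)\|$ vanishes at infinity on $E\backslash E^{(0)}$; it has the pointwise operations and the supremum norm. It is a $C^*$-algebra. (1) The orbit space $E\backslash E^{(0)}$ is a second countable locally compact Hausdorff space, $\mathrm{Ind}_{E^{(0)}}^{E}(A,\alpha)$ is separable, and the formula $Q_\phi(f)(u)=\phi(E\cdot u)f(u)$, for $\phi\in C_0(E\backslash E^{(0)})$, $f\in \mathrm{Ind}_{E^{(0)}}^{E}(A,\alpha)$ and $u\in E^{(0)}$, defines a nondegenerate $*$-homomorphism $\phi\mapsto Q_\phi$ from $C_0(E\backslash E^{(0)})$ to the centre of the multiplier algebra of $\mathrm{Ind}_{E^{(0)}}^{E}(A,\alpha)$. Thus $Q$ makes $\mathrm{Ind}_{E^{(0)}}^{E}(A,\alpha)$ a $C_0(E\backslash E^{(0)})$-algebra. For $u\in E^{(0)}$ let $\mathrm{Ind}_{E^{(0)}}^{E}(A,\alpha)(E\cdot u)$ be the fibre of this $C_0(E\backslash E^{(0)})$-algebra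 over $E\cdot u$: the quotient of $\mathrm{Ind}_{E^{(0)}}^{E}(A,\alpha)$ by the closed linear span of all $Q_\phi(f)$ with $f\in \mathrm{Ind}_{E^{(0)}}^{E}(A,\alpha)$ and $\phi(E\cdot u)=0$. Then, for every $u\in E^{(0)}$: (2) $E|_{E\cdot u}$ is again a locally compact principal and proper groupoid with a Haar system, with locally compact unit space $E\cdot u$, and the restriction map $f\mapsto f|_{E\cdot u}$ induces an (isometric) $*$-isomorphism $$R:\mathrm{Ind}_{E^{(0)}}^{E}(A,\alpha)(E\cdot u)\to \mathrm{Ind}_{E\cdot u}^{E|_{E\cdot u}}(\Gamma_0(E\cdot u,\mathscr{A}),\alpha),$$ where the target is the induced algebra of the restriction of $\mathscr{A}$ and $\alpha$ to $E\cdot u$ and $E|_{E\cdot u}$. (3) The evaluation map $f\mapsto f(u)$ factors to an (isometric) $*$-isomorphism of $\mathrm{Ind}_{E^{(0)}}^{E}(A,\alpha)(E\cdot u)$ with $A(u)$. -/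

import Mathlib

open Topology Filter Set MeasureTheory
open scoped ENNReal ZeroAtInfty MultiplierAlgebra

noncomputable section

/-! ### Topological groupoids -/

/-- A topological groupoid with space of arrows `E` and space of units `X`.  The unit space is
identified with the set of identity arrows through `unit`; since `r`, `s` and `unit` are continuous
and `r ∘ unit = id`, the map `unit` is a homeomorphism onto the set of identity arrows, so `X` is
`E⁽⁰⁾` with the relative topology.  The product `γ η` is defined when `s γ = r η`. -/
structure TopologicalGroupoid (E X : Type*) [TopologicalSpace E] [TopologicalSpace X] where
  r : E → X
  s : E → X
  unit : X → E
  inv : E → E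
  mul : (γ η : E) → s γ = r η → E
  r_unit : ∀ x, r (unit x) = x
  s_unit : ∀ x, s (unit x) = x
  r_inv : ∀ γ, r (inv γ) = s γ
  s_inv : ∀ γ, s (inv γ) = r γ
  r_mul : ∀ γ η h, r (mul γ η h) = r γ
  s_mul : ∀ γ η h, s (mul γ η h) = s η
  mul_assoc : ∀ γ η ζ (h : s γ = r η) (k : s η = r ζ),
    mul (mul γ η h) ζ ((s_mul γ η h).trans k) = mul γ (mul η ζ k) (h.trans (r_mul η ζ k).symm)
  unit_mul : ∀ γ, mul (unit (r γ)) γ (s_unit _) = γ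
  mul_unit : ∀ γ, mul γ (unit (s γ)) (r_unit _).symm = γ
  mul_inv : ∀ γ, mul γ (inv γ) (r_inv γ).symm = unit (r γ)
  inv_mul : ∀ γ, mul (inv γ) γ (s_inv γ) = unit (s γ)
  continuous_r : Continuous r
  continuous_s : Continuous s
  continuous_unit : Continuous unit
  continuous_inv : Continuous inv
  continuous_mul : Continuous fun p : {p : E × E // s p.1 = r p.2} => mul p.1.1 p.1.2 p.2

namespace TopologicalGroupoid

variable {E X : Type*} [TopologicalSpace E] [TopologicalSpace X] (G : TopologicalGroupoid E X)

/-- `E` is principal: its action `γ · s γ = r γ` on the unit space is free. -/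
def IsPrincipal : Prop :=
  ∀ γ, G.r γ = G.s γ → γ = G.unit (G.s γ)

/-- `E` is proper: its action on the unit space is proper, that is, for compact sets `K`, `L` of
units the set of all `γ` with `γ · K ∩ L ≠ ∅` is compact. -/
def IsProper : Prop :=
  ∀ K L : Set X, IsCompact K → IsCompact L → IsCompact {γ | G.s γ ∈ K ∧ G.r γ ∈ L}

/-- The orbit `E · u = {r γ : s γ = u}`. -/
def orbit (u : X) : Set X :=
  {v | ∃ γ, G.s γ = u ∧ G.r γ = v}

/-- Two units are equivalent if they lie in the same orbit. -/
def orbitSetoid : Setoid X where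
  r u v := ∃ γ, G.s γ = u ∧ G.r γ = v
  iseqv :=
    { refl := fun x => ⟨G.unit x, G.s_unit x, G.r_unit x⟩
      symm := by
        rintro _ _ ⟨γ, rfl, rfl⟩
        exact ⟨G.inv γ, G.s_inv γ, G.r_inv γ⟩
      trans := by
        rintro _ _ _ ⟨γ, rfl, rfl⟩ ⟨η, h, rfl⟩
        exact ⟨G.mul η γ h, G.s_mul _ _ _, G.r_mul _ _ _⟩ }

/-- The orbit space `E \ E⁽⁰⁾`. -/
def OrbitSpace : Type _ := Quotient G.orbitSetoid

/-- The orbit space carries the quotient topology. -/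
instance : TopologicalSpace G.OrbitSpace :=
  inferInstanceAs (TopologicalSpace (Quotient G.orbitSetoid))

/-- The quotient map `u ↦ E · u`, with values in the orbit space. -/
def orbitMap (u : X) : G.OrbitSpace := Quotient.mk G.orbitSetoid u

theorem isQuotientMap_orbitMap : IsQuotientMap G.orbitMap := isQuotientMap_quot_mk

theorem orbitMap_eq {u v : X} : G.orbitMap u = G.orbitMap v ↔ ∃ γ, G.s γ = u ∧ G.r γ = v :=
  Quotient.eq (r := G.orbitSetoid)

/-- The restriction `E|_D = {γ : r γ ∈ D, s γ ∈ D}`, a groupoid with unit space `D`. -/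
def restrict (D : Set X) : TopologicalGroupoid {γ : E // G.r γ ∈ D ∧ G.s γ ∈ D} D where
  r γ := ⟨G.r γ.1, γ.2.1⟩
  s γ := ⟨G.s γ.1, γ.2.2⟩
  unit x := ⟨G.unit x.1, by rw [G.r_unit]; exact x.2, by rw [G.s_unit]; exact x.2⟩
  inv γ := ⟨G.inv γ.1, by rw [G.r_inv]; exact γ.2.2, by rw [G.s_inv]; exact γ.2.1⟩
  mul γ η h := ⟨G.mul γ.1 η.1 (congrArg Subtype.val h),
    by rw [G.r_mul]; exact γ.2.1, by rw [G.s_mul]; exact η.2.2⟩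
  r_unit x := Subtype.ext (G.r_unit _)
  s_unit x := Subtype.ext (G.s_unit _)
  r_inv γ := Subtype.ext (G.r_inv _)
  s_inv γ := Subtype.ext (G.s_inv _)
  r_mul γ η h := Subtype.ext (G.r_mul _ _ _)
  s_mul γ η h := Subtype.ext (G.s_mul _ _ _)
  mul_assoc γ η ζ h k := Subtype.ext (G.mul_assoc _ _ _ _ _)
  unit_mul γ := Subtype.ext (G.unit_mul _)
  mul_unit γ := Subtype.ext (G.mul_unit _)
  mul_inv γ := Subtype.ext (G.mul_inv _)
  inv_mul γ := Subtype.ext (G.inv_mul _)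
  continuous_r := (G.continuous_r.comp continuous_subtype_val).subtype_mk _
  continuous_s := (G.continuous_s.comp continuous_subtype_val).subtype_mk _
  continuous_unit := (G.continuous_unit.comp continuous_subtype_val).subtype_mk _
  continuous_inv := (G.continuous_inv.comp continuous_subtype_val).subtype_mk _
  continuous_mul := by
    refine Continuous.subtype_mk ?_ _
    refine G.continuous_mul.comp
      (f := fun p : {p : {γ : E // G.r γ ∈ D ∧ G.s γ ∈ D} × {γ : E // G.r γ ∈ D ∧ G.s γ ∈ D} //
        (⟨G.s p.1.1, p.1.2.2⟩ : D) = ⟨G.r p.2.1, p.2.2.1⟩} =>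
        (⟨(p.1.1.1, p.1.2.1), congrArg Subtype.val p.2⟩ : {p : E × E // G.s p.1 = G.r p.2})) ?_
    fun_prop

/-- A (left) Haar system on a second countable locally compact Hausdorff groupoid: a family of
Radon measures `μ u` with support `r ⁻¹ {u}` which is continuous and left invariant. -/
structure HaarSystem [MeasurableSpace E] where
  μ : X → Measure E
  finite_on_compacts : ∀ u, IsFiniteMeasureOnCompacts (μ u)
  support_eq : ∀ u, (μ u).support = {γ | G.r γ = u}
  continuous_integral : ∀ f : E → ℂ, Continuous f → HasCompactSupport f →
    Continuous fun u => ∫ γ, f γ ∂(μ u)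
  /-- Left invariance; the left-hand integral, of the function `γ ↦ f (η γ)`, is taken over
  `r ⁻¹ {s η}`, where `η γ` is defined and where the measure `μ (s η)` is concentrated. -/
  left_invariant : ∀ (η : E) (f : E → ℂ), Continuous f → HasCompactSupport f →
    ∫ γ : {γ : E // G.s η = G.r γ}, f (G.mul η γ.1 γ.2) ∂((μ (G.s η)).comap Subtype.val) =
      ∫ γ, f γ ∂(μ (G.r η))

end TopologicalGroupoid

/-! ### Upper semicontinuous C⋆-bundles -/

/-- The total space `⨆ₜ A t` (disjoint union) of a family of fibres, without a topology. -/
abbrev Tot {T : Type*} (A : T → Type*) : Type _ := Bundle.TotalSpace PUnit.{1} A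

/-- The fibred product `{(z, w) : p z = p w}` of the total space with itself, as the set of triples
`(t, (a, b))` with `a`, `b` in the fibre over `t`. -/
abbrev Tot₂ {T : Type*} (A : T → Type*) : Type _ := Tot fun t => A t × A t

/-- The relative topology of the fibred product in the product of the total spaces. -/
abbrev fibredProductTopology {T : Type*} (A : T → Type*) (top : TopologicalSpace (Tot A)) :
    TopologicalSpace (Tot₂ A) :=
  .induced (fun z => ((⟨z.proj, z.snd.1⟩, ⟨z.proj, z.snd.2⟩) : Tot A × Tot A)) inferInstance

/-- The structure of an upper semicontinuous C⋆-bundle over `T` on a family `A` of C⋆-algebras: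
a topology on the total space which satisfies the axioms. (The projection is onto, because every
fibre has a zero element.) -/
structure USCBundle {T : Type*} [TopologicalSpace T] (A : T → Type*)
    [∀ t, NonUnitalCStarAlgebra (A t)] where
  top : TopologicalSpace (Tot A)
  continuous_proj : Continuous fun z : Tot A => z.proj
  isOpenMap_proj : IsOpenMap fun z : Tot A => z.proj
  upperSemicontinuous_norm : UpperSemicontinuous fun z : Tot A => ‖z.snd‖
  continuous_add : Continuous[fibredProductTopology A top, top] fun z : Tot₂ A =>
    (⟨z.proj, z.snd.1 + z.snd.2⟩ : Tot A)
  continuous_smul : ∀ k : ℂ, Continuous fun z : Tot A => (⟨z.proj, k • z.snd⟩ : Tot A)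
  /-- If `‖zᵢ‖ → 0` and `p zᵢ → t`, then `zᵢ → 0ₜ`. -/
  tendsto_zero : ∀ (t : T) (F : Filter (Tot A)), Tendsto (fun z => ‖z.snd‖) F (𝓝 0) →
    Tendsto (fun z => z.proj) F (𝓝 t) → Tendsto id F (𝓝 (⟨t, 0⟩ : Tot A))
  continuous_mul : Continuous[fibredProductTopology A top, top] fun z : Tot₂ A =>
    (⟨z.proj, z.snd.1 * z.snd.2⟩ : Tot A)
  continuous_star : Continuous fun z : Tot A => (⟨z.proj, star z.snd⟩ : Tot A)

namespace USCBundle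

variable {T : Type*} [TopologicalSpace T] {A : T → Type*} [∀ t, NonUnitalCStarAlgebra (A t)]
  (B : USCBundle A)

/-- A section `f` of the bundle is continuous. -/
def IsContinuousSection (f : ∀ t, A t) : Prop :=
  letI := B.top
  Continuous fun t => (⟨t, f t⟩ : Tot A)

/-- The section algebra `Γ₀(T, A)`: continuous sections which vanish at infinity, a subset of
the C⋆-algebra of all bounded sections with the supremum norm. -/
def sections₀ : Set (lp A ∞) :=
  {f | B.IsContinuousSection f ∧ ∀ ε : ℝ, 0 < ε → IsCompact {t | ε ≤ ‖f t‖}}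

theorem isContinuousSection_iff {f : ∀ t, A t} : B.IsContinuousSection f ↔
    ∀ t, @Tendsto _ _ (fun t => (⟨t, f t⟩ : Tot A)) (𝓝 t) (@nhds _ B.top ⟨t, f t⟩) := by
  let := B.top
  exact continuous_iff_continuousAt

theorem isClosed_of_section {f : ∀ t, A t} (hf : B.IsContinuousSection f) (ε : ℝ) :
    IsClosed {t | ε ≤ ‖f t‖} := by
  let := B.top
  exact (B.upperSemicontinuous_norm.comp hf).isClosed_preimage ε

theorem isContinuousSection_zero : B.IsContinuousSection (0 : ∀ t, A t) := by
  let := B.top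
  rw [isContinuousSection_iff]
  intro t
  have := B.tendsto_zero t (Filter.map (fun t => (⟨t, 0⟩ : Tot A)) (𝓝 t))
    (by simp [Filter.tendsto_map'_iff, Function.comp_def])
    (Filter.tendsto_map'_iff.2 tendsto_id)
  exact this

theorem continuous_pair {Y : Type*} [TopologicalSpace Y] (p : Y → T) (f g : ∀ y, A (p y))
    (hf : @Continuous _ _ _ B.top fun y => (⟨p y, f y⟩ : Tot A))
    (hg : @Continuous _ _ _ B.top fun y => (⟨p y, g y⟩ : Tot A)) :
    @Continuous _ _ _ (fibredProductTopology A B.top)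
      fun y => (⟨p y, (f y, g y)⟩ : Tot₂ A) := by
  let := B.top
  rw [continuous_induced_rng]
  exact hf.prodMk hg

theorem IsContinuousSection.add {f g : ∀ t, A t} (hf : B.IsContinuousSection f)
    (hg : B.IsContinuousSection g) : B.IsContinuousSection (f + g) := by
  let := B.top
  let := fibredProductTopology A B.top
  exact B.continuous_add.comp (B.continuous_pair id f g hf hg)

theorem IsContinuousSection.mul {f g : ∀ t, A t} (hf : B.IsContinuousSection f)
    (hg : B.IsContinuousSection g) : B.IsContinuousSection (f * g) := by
  let := B.top
  let := fibredProductTopology A B.top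
  exact B.continuous_mul.comp (B.continuous_pair id f g hf hg)

theorem IsContinuousSection.smul {f : ∀ t, A t} (hf : B.IsContinuousSection f) (k : ℂ) :
    B.IsContinuousSection (k • f) := by
  let := B.top
  exact (B.continuous_smul k).comp hf

theorem IsContinuousSection.star {f : ∀ t, A t} (hf : B.IsContinuousSection f) :
    B.IsContinuousSection (star f) := by
  let := B.top
  exact B.continuous_star.comp hf

/-- A uniform limit of continuous sections is continuous. -/
theorem isContinuousSection_of_approx {f : ∀ t, A t}
    (h : ∀ ε : ℝ, 0 < ε → ∃ g : ∀ t, A t, B.IsContinuousSection g ∧ ∀ t, ‖f t - g t‖ ≤ ε) :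
    B.IsContinuousSection f := by
  let := B.top
  let := fibredProductTopology A B.top
  rw [isContinuousSection_iff]
  intro t
  have hp : Tendsto (fun z : Tot A => z.proj) (𝓝 (⟨t, f t⟩ : Tot A)) (𝓝 t) :=
    B.continuous_proj.tendsto (⟨t, f t⟩ : Tot A)
  have hd : Tendsto (fun z : Tot A => (⟨z.proj, f z.proj - z.snd⟩ : Tot A))
      (𝓝 (⟨t, f t⟩ : Tot A)) (𝓝 (⟨t, 0⟩ : Tot A)) := by
    refine B.tendsto_zero t (Filter.map (fun z : Tot A => (⟨z.proj, f z.proj - z.snd⟩ : Tot A))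
      (𝓝 (⟨t, f t⟩ : Tot A))) ?_ (Filter.tendsto_map'_iff.2 hp)
    rw [Filter.tendsto_map'_iff]
    refine tendsto_order.2 ⟨fun a ha => Eventually.of_forall fun z =>
      ha.trans_le (norm_nonneg _), fun ε hε => ?_⟩
    obtain ⟨g, hg, hfg⟩ := h (ε / 3) (by positivity)
    have hc : Continuous fun z : Tot A => (⟨z.proj, g z.proj - z.snd⟩ : Tot A) := by
      have h1 : Continuous fun z : Tot A => (⟨z.proj, g z.proj⟩ : Tot A) :=
        Continuous.comp hg B.continuous_proj
      have h2 := B.continuous_smul (-1)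
      simpa [sub_eq_add_neg, Function.comp_def] using B.continuous_add.comp
        (B.continuous_pair (fun z : Tot A => z.proj) _ _ h1 h2)
    have hu := (B.upperSemicontinuous_norm.comp hc) (⟨t, f t⟩ : Tot A) (ε / 2) (by
      have := hfg t
      rw [norm_sub_rev] at this
      simp only [Function.comp]
      linarith)
    filter_upwards [hu] with z hz
    simp only [Function.comp] at hz ⊢
    have h3 : f z.proj - z.snd = (f z.proj - g z.proj) + (g z.proj - z.snd) := by abel
    rw [h3]
    have := norm_add_le (f z.proj - g z.proj) (g z.proj - z.snd)
    have := hfg z.proj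
    linarith
  have key : Tendsto (fun z : Tot A => (⟨z.proj, f z.proj⟩ : Tot A)) (𝓝 (⟨t, f t⟩ : Tot A))
      (𝓝 (⟨t, f t⟩ : Tot A)) := by
    have h4 : Tendsto (fun z : Tot A => (⟨z.proj, (z.snd, f z.proj - z.snd)⟩ : Tot₂ A))
        (𝓝 (⟨t, f t⟩ : Tot A)) (𝓝 (⟨t, (f t, 0)⟩ : Tot₂ A)) := by
      rw [nhds_induced, Filter.tendsto_comap_iff, nhds_prod_eq]
      exact tendsto_id.prodMk hd
    have h5 := (B.continuous_add.tendsto (⟨t, (f t, 0)⟩ : Tot₂ A)).comp h4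
    simpa [Function.comp_def] using h5
  have h6 : 𝓝 t ≤ Filter.map (fun z : Tot A => z.proj) (𝓝 (⟨t, f t⟩ : Tot A)) :=
    B.isOpenMap_proj.nhds_le (⟨t, f t⟩ : Tot A)
  exact (Filter.tendsto_map'_iff.2 key).mono_left h6

/-- The inclusion of the restricted total space `p ⁻¹ D` in the total space. -/
def totIncl (A : T → Type*) (D : Set T) (z : Tot fun t : D => A t) : Tot A := ⟨z.proj, z.snd⟩

/-- The restriction of the bundle to a subset `D` of the base: the fibres are those over the points
of `D`, and the total space `p ⁻¹ D` carries the relative topology. -/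
def restrict (D : Set T) : USCBundle fun t : D => A t where
  top := .induced (totIncl A D) B.top
  continuous_proj := by
    let := B.top
    let : TopologicalSpace (Tot fun t : D => A t) := .induced (totIncl A D) B.top
    have hi : Continuous (totIncl A D) := continuous_induced_dom
    refine continuous_induced_rng.2 ?_
    exact B.continuous_proj.comp hi
  isOpenMap_proj := by
    let := B.top
    let : TopologicalSpace (Tot fun t : D => A t) := .induced (totIncl A D) B.top
    have hi : Continuous (totIncl A D) := continuous_induced_dom
    rintro U ⟨V, hV, rfl⟩
    refine ⟨_, B.isOpenMap_proj V hV, ?_⟩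
    ext t
    constructor
    · rintro ⟨⟨x, a⟩, hz, h⟩
      obtain rfl : x = t.1 := h
      exact ⟨⟨t, a⟩, hz, rfl⟩
    · rintro ⟨z, hz, rfl⟩
      exact ⟨⟨z.proj, z.snd⟩, hz, rfl⟩
  upperSemicontinuous_norm := by
    let := B.top
    let : TopologicalSpace (Tot fun t : D => A t) := .induced (totIncl A D) B.top
    have hi : Continuous (totIncl A D) := continuous_induced_dom
    exact B.upperSemicontinuous_norm.comp hi
  continuous_add := by
    let := B.top
    let : TopologicalSpace (Tot fun t : D => A t) := .induced (totIncl A D) B.top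
    have hi : Continuous (totIncl A D) := continuous_induced_dom
    let := fibredProductTopology A B.top
    let := fibredProductTopology (fun t : D => A t) inferInstance
    have hj : Continuous fun z : Tot₂ fun t : D => A t =>
        (((⟨z.proj, z.snd.1⟩, ⟨z.proj, z.snd.2⟩) : (Tot fun t : D => A t) × Tot fun t : D => A t)) :=
      continuous_induced_dom
    rw [continuous_induced_rng]
    refine B.continuous_add.comp (B.continuous_pair (fun z : Tot₂ fun t : D => A t => z.proj.1)
      (fun z => z.snd.1) (fun z => z.snd.2) ?_ ?_)
    · exact hi.comp (continuous_fst.comp hj)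
    · exact hi.comp (continuous_snd.comp hj)
  continuous_smul k := by
    let := B.top
    let : TopologicalSpace (Tot fun t : D => A t) := .induced (totIncl A D) B.top
    have hi : Continuous (totIncl A D) := continuous_induced_dom
    rw [continuous_induced_rng]
    exact (B.continuous_smul k).comp hi
  tendsto_zero t F h1 h2 := by
    let := B.top
    let : TopologicalSpace (Tot fun t : D => A t) := .induced (totIncl A D) B.top
    have hi : Continuous (totIncl A D) := continuous_induced_dom
    rw [nhds_induced, Filter.tendsto_comap_iff]
    refine Filter.tendsto_map'_iff.1 (B.tendsto_zero t.1 (Filter.map (totIncl A D) F) ?_ ?_)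
    · exact Filter.tendsto_map'_iff.2 h1
    · exact Filter.tendsto_map'_iff.2 ((continuous_subtype_val.tendsto t).comp h2)
  continuous_mul := by
    let := B.top
    let : TopologicalSpace (Tot fun t : D => A t) := .induced (totIncl A D) B.top
    have hi : Continuous (totIncl A D) := continuous_induced_dom
    let := fibredProductTopology A B.top
    let := fibredProductTopology (fun t : D => A t) inferInstance
    have hj : Continuous fun z : Tot₂ fun t : D => A t =>
        (((⟨z.proj, z.snd.1⟩, ⟨z.proj, z.snd.2⟩) : (Tot fun t : D => A t) × Tot fun t : D => A t)) :=
      continuous_induced_dom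
    rw [continuous_induced_rng]
    refine B.continuous_mul.comp (B.continuous_pair (fun z : Tot₂ fun t : D => A t => z.proj.1)
      (fun z => z.snd.1) (fun z => z.snd.2) ?_ ?_)
    · exact hi.comp (continuous_fst.comp hj)
    · exact hi.comp (continuous_snd.comp hj)
  continuous_star := by
    let := B.top
    let : TopologicalSpace (Tot fun t : D => A t) := .induced (totIncl A D) B.top
    have hi : Continuous (totIncl A D) := continuous_induced_dom
    rw [continuous_induced_rng]
    exact B.continuous_star.comp hi

end USCBundle

/-! ### Groupoid actions on bundles and induced algebras -/

/-- An action of the groupoid `G` on an upper semicontinuous C⋆-bundle over its unit space: norm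
preserving `*`-isomorphisms `V γ : A (s γ) ≃ A (r γ)`, with `V γ ∘ V η = V (γ η)`, which together
define a continuous map.  (Here `V γ` takes proofs of `s γ = x` and `r γ = y` and is a map from
`A x` to `A y`, so that compositions make sense literally.) -/
structure GroupoidAction {E X : Type*} [TopologicalSpace E] [TopologicalSpace X]
    (G : TopologicalGroupoid E X) {A : X → Type*} [∀ x, NonUnitalCStarAlgebra (A x)]
    (B : USCBundle A) where
  V : (γ : E) → {x y : X} → G.s γ = x → G.r γ = y → (A x ≃⋆ₐ[ℂ] A y)
  norm_V : ∀ (γ : E) {x y : X} (hx : G.s γ = x) (hy : G.r γ = y) (a : A x), ‖V γ hx hy a‖ = ‖a‖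
  V_mul : ∀ (γ η : E) {x y z : X} (hx : G.s η = x) (hy : G.r η = y) (hy' : G.s γ = y)
    (hz : G.r γ = z) (a : A x),
    V γ hy' hz (V η hx hy a) =
      V (G.mul γ η (hy'.trans hy.symm)) ((G.s_mul _ _ _).trans hx) ((G.r_mul _ _ _).trans hz) a
  continuous_V : letI := B.top
    Continuous fun p : {p : E × Tot A // G.s p.1 = p.2.proj} =>
      (⟨G.r p.1.1, V p.1.1 p.2 rfl p.1.2.snd⟩ : Tot A)

namespace GroupoidAction

variable {E X : Type*} [TopologicalSpace E] [TopologicalSpace X] {G : TopologicalGroupoid E X}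
  {A : X → Type*} [∀ x, NonUnitalCStarAlgebra (A x)] {B : USCBundle A} (α : GroupoidAction G B)

/-- The restriction of an action of `E` to an action of `E|_D` on the restricted bundle. -/
def restrict (D : Set X) : GroupoidAction (G.restrict D) (B.restrict D) where
  V γ _ _ hx hy := α.V γ.1 (congrArg Subtype.val hx) (congrArg Subtype.val hy)
  norm_V γ _ _ _ _ a := α.norm_V γ.1 _ _ a
  V_mul γ η _ _ _ _ _ _ _ a := α.V_mul γ.1 η.1 _ _ _ _ a
  continuous_V := by
    let := B.top
    let : TopologicalSpace (Tot fun t : D => A t) := (B.restrict D).top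
    refine continuous_induced_rng.2 ?_
    refine Continuous.comp α.continuous_V
      (f := fun p : {p : {γ : E // G.r γ ∈ D ∧ G.s γ ∈ D} × Tot (fun t : D => A t) //
        (G.restrict D).s p.1 = p.2.proj} =>
        (⟨(p.1.1.1, (⟨p.1.2.proj, p.1.2.snd⟩ : Tot A)), congrArg Subtype.val p.2⟩ :
          {p : E × Tot A // G.s p.1 = p.2.proj})) ?_
    refine Continuous.subtype_mk (Continuous.prodMk ?_ ?_) _
    · exact continuous_subtype_val.comp (continuous_fst.comp continuous_subtype_val)
    · have : Continuous (USCBundle.totIncl A D) := continuous_induced_dom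
      exact this.comp (continuous_snd.comp continuous_subtype_val)

/-- A section is equivariant: `f (r γ) = V γ (f (s γ))`. -/
def IsEquivariant (f : ∀ x, A x) : Prop :=
  ∀ γ, f (G.r γ) = α.V γ rfl rfl (f (G.s γ))

/-- `E · u ↦ ‖f u‖` vanishes at infinity on the orbit space: for every `ε > 0` the set of all
orbits `E · u` with `‖f u‖ ≥ ε` is compact. -/
def VanishesAtInfinity (G : TopologicalGroupoid E X) (f : ∀ x, A x) : Prop :=
  ∀ ε : ℝ, 0 < ε → IsCompact (G.orbitMap '' {x | ε ≤ ‖f x‖})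

variable {α}

theorem IsEquivariant.norm_eq {f : ∀ x, A x} (hf : α.IsEquivariant f) (γ : E) :
    ‖f (G.r γ)‖ = ‖f (G.s γ)‖ := by
  rw [hf γ, α.norm_V]

theorem isClosed_image {f : ∀ x, A x} (hf : α.IsEquivariant f) (hc : B.IsContinuousSection f)
    (ε : ℝ) : IsClosed (G.orbitMap '' {x | ε ≤ ‖f x‖}) := by
  rw [← G.isQuotientMap_orbitMap.isClosed_preimage]
  convert B.isClosed_of_section hc ε using 1
  ext v
  constructor
  · rintro ⟨u, hu, h⟩
    obtain ⟨γ, rfl, rfl⟩ := G.orbitMap_eq.1 h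
    simpa [hf.norm_eq] using hu
  · exact fun hv => ⟨v, hv, rfl⟩

theorem VanishesAtInfinity.of_subset {f : ∀ x, A x} (hf : α.IsEquivariant f)
    (hc : B.IsContinuousSection f)
    (h : ∀ ε : ℝ, 0 < ε → ∃ K, IsCompact K ∧ G.orbitMap '' {x | ε ≤ ‖f x‖} ⊆ K) :
    VanishesAtInfinity G f := fun ε hε => by
  obtain ⟨K, hK, hs⟩ := h ε hε
  exact hK.of_isClosed_subset (isClosed_image hf hc ε) hs

variable (α)

/-- The induced algebra `Ind(A, α)`: the bounded continuous equivariant sections `f` for which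
`E · u ↦ ‖f u‖` vanishes at infinity, as a `*`-subalgebra of the C⋆-algebra of all bounded
sections with pointwise operations and the supremum norm. -/
def Ind : NonUnitalStarSubalgebra ℂ (lp A ∞) where
  carrier := {f | B.IsContinuousSection f ∧ α.IsEquivariant f ∧ VanishesAtInfinity G f}
  zero_mem' := by
    refine ⟨B.isContinuousSection_zero, fun γ => by simp, fun ε hε => ?_⟩
    have : {x : X | ε ≤ ‖(0 : lp A ∞) x‖} = ∅ := by
      ext x
      simp [hε]
    rw [this, image_empty]
    exact isCompact_empty
  add_mem' := by
    rintro f g ⟨f1, f2, f3⟩ ⟨g1, g2, g3⟩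
    have h1 : B.IsContinuousSection (f + g : lp A ∞) := f1.add B g1
    have h2 : α.IsEquivariant (f + g : lp A ∞) := fun γ => by simp [f2 γ, g2 γ]
    refine ⟨h1, h2, .of_subset h2 h1 fun ε hε =>
      ⟨_, (f3 (ε / 2) (half_pos hε)).union (g3 (ε / 2) (half_pos hε)), ?_⟩⟩
    rw [← image_union]
    refine image_mono fun x hx => ?_
    by_contra hn
    simp only [mem_union, mem_ofPred_eq, not_or, not_le] at hn hx
    have := norm_add_le (f x) (g x)
    simp only [lp.coeFn_add, Pi.add_apply] at hx
    linarith [hn.1, hn.2]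
  mul_mem' := by
    rintro f g ⟨f1, f2, f3⟩ ⟨g1, g2, g3⟩
    have h1 : B.IsContinuousSection (f * g : lp A ∞) := f1.mul B g1
    have h2 : α.IsEquivariant (f * g : lp A ∞) := fun γ => by
      simp [lp.infty_coeFn_mul, f2 γ, g2 γ]
    refine ⟨h1, h2, .of_subset h2 h1 fun ε hε => ⟨_, f3 (ε / (‖g‖ + 1)) (by positivity), ?_⟩⟩
    refine image_mono fun x hx => ?_
    simp only [mem_ofPred_eq, lp.infty_coeFn_mul, Pi.mul_apply] at hx ⊢
    rw [div_le_iff₀ (by positivity)]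
    have h3 := norm_mul_le (f x) (g x)
    have h4 := lp.norm_apply_le_norm ENNReal.top_ne_zero g x
    nlinarith [norm_nonneg (f x)]
  smul_mem' := by
    rintro k f ⟨f1, f2, f3⟩
    have h1 : B.IsContinuousSection (k • f : lp A ∞) := f1.smul B k
    have h2 : α.IsEquivariant (k • f : lp A ∞) := fun γ => by simp [f2 γ]
    refine ⟨h1, h2, .of_subset h2 h1 fun ε hε => ⟨_, f3 (ε / (‖k‖ + 1)) (by positivity), ?_⟩⟩
    refine image_mono fun x hx => ?_
    simp only [mem_ofPred_eq, lp.coeFn_smul, Pi.smul_apply, norm_smul] at hx ⊢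
    rw [div_le_iff₀ (by positivity)]
    nlinarith [norm_nonneg (f x)]
  star_mem' := by
    rintro f ⟨f1, f2, f3⟩
    refine ⟨f1.star B, fun γ => ?_, fun ε hε => ?_⟩
    · simp [f2 γ, map_star]
    · simpa using f3 ε hε

/-- `Ind(A, α)` is closed in the supremum norm. -/
instance isClosed_ind : IsClosed (α.Ind : Set (lp A ∞)) := by
  refine isClosed_of_closure_subset fun f hf => ?_
  have key : ∀ ε : ℝ, 0 < ε → ∃ g ∈ (α.Ind : Set (lp A ∞)), ∀ x, ‖f x - g x‖ ≤ ε := by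
    intro ε hε
    obtain ⟨g, hg, hd⟩ := Metric.mem_closure_iff.1 hf ε hε
    refine ⟨g, hg, fun x => ?_⟩
    rw [dist_eq_norm] at hd
    exact (lp.norm_apply_le_norm ENNReal.top_ne_zero (f - g) x).trans hd.le
  have h1 : B.IsContinuousSection f := B.isContinuousSection_of_approx fun ε hε => by
    obtain ⟨g, hg, h⟩ := key ε hε
    exact ⟨g, hg.1, h⟩
  have h2 : α.IsEquivariant f := fun γ => by
    refine eq_of_forall_dist_le fun ε hε => ?_
    obtain ⟨g, hg, h⟩ := key (ε / 2) (half_pos hε)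
    have e1 := h (G.r γ)
    have e2 : ‖α.V γ rfl rfl (f (G.s γ) - g (G.s γ))‖ ≤ ε / 2 := by
      rw [α.norm_V]; exact h _
    rw [dist_eq_norm]
    have e3 : f (G.r γ) - α.V γ rfl rfl (f (G.s γ)) =
        (f (G.r γ) - g (G.r γ)) - α.V γ rfl rfl (f (G.s γ) - g (G.s γ)) := by
      rw [map_sub, ← hg.2.1 γ]; abel
    rw [e3]
    exact (norm_sub_le _ _).trans (by linarith)
  refine ⟨h1, h2, .of_subset h2 h1 fun ε hε => ?_⟩
  obtain ⟨g, hg, h⟩ := key (ε / 2) (half_pos hε)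
  refine ⟨_, hg.2.2 (ε / 2) (half_pos hε), image_mono fun x hx => ?_⟩
  have e1 := norm_sub_norm_le (f x) (g x)
  have e2 := h x
  simp only [mem_ofPred_eq] at hx ⊢
  linarith

instance : NonUnitalCStarAlgebra α.Ind := NonUnitalStarSubalgebra.nonUnitalCStarAlgebra α.Ind

end GroupoidAction

/-! ### `C₀(T)`-algebras and their fibres -/

/-- The structure of a `C₀(T)`-algebra on a C⋆-algebra `B`, for `T` a second countable locally
compact Hausdorff space and `B` separable: a nondegenerate `*`-homomorphism from `C₀(T)` to the
centre of the multiplier algebra of `B`. -/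
structure C0Algebra (T : Type*) [TopologicalSpace T] (B : Type*) [NonUnitalCStarAlgebra B] where
  t2Space : T2Space T
  locallyCompactSpace : LocallyCompactSpace T
  secondCountableTopology : SecondCountableTopology T
  separableSpace : TopologicalSpace.SeparableSpace B
  toHom : C₀(T, ℂ) →⋆ₙₐ[ℂ] 𝓜(ℂ, B)
  mem_center : ∀ φ, toHom φ ∈ Set.center 𝓜(ℂ, B)
  nondegenerate :
    (Submodule.span ℂ {x : B | ∃ (φ : C₀(T, ℂ)) (b : B), x = (toHom φ).fst b}).topologicalClosure = ⊤

namespace C0Algebra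

variable {T : Type*} [TopologicalSpace T] {B : Type*} [NonUnitalCStarAlgebra B]
  (Θ : C0Algebra T B)

/-- The ideal `I_t`, the closed linear span of all `φ · b` with `φ ∈ C₀(T)`, `φ t = 0` and
`b ∈ B`. -/
def fibreIdeal (t : T) : Submodule ℂ B :=
  (Submodule.span ℂ {x : B | ∃ (φ : C₀(T, ℂ)) (b : B), φ t = 0 ∧ x = (Θ.toHom φ).fst b}).topologicalClosure


theorem fst_mul (φ : C₀(T, ℂ)) (b c : B) :
    (Θ.toHom φ).fst (b * c) = b * (Θ.toHom φ).fst c := by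
  have h := ((Θ.mem_center φ).comm (b : 𝓜(ℂ, B))).eq
  exact congrArg (fun m : 𝓜(ℂ, B) => m.fst c) h

theorem fst_mul' (φ : C₀(T, ℂ)) (b c : B) :
    (Θ.toHom φ).fst (b * c) = (Θ.toHom φ).fst b * c := by
  have h : ∀ x : B, x * ((Θ.toHom φ).fst (b * c) - (Θ.toHom φ).fst b * c) = 0 := fun x => by
    rw [mul_sub, ← (Θ.toHom φ).central, ← mul_assoc x, ← (Θ.toHom φ).central, mul_assoc, sub_self]
  have := h (star ((Θ.toHom φ).fst (b * c) - (Θ.toHom φ).fst b * c))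
  rwa [CStarRing.star_mul_self_eq_zero_iff, sub_eq_zero] at this

theorem snd_eq_fst (φ : C₀(T, ℂ)) (b : B) : (Θ.toHom φ).snd b = (Θ.toHom φ).fst b := by
  have h : ∀ x : B, ((Θ.toHom φ).snd b - (Θ.toHom φ).fst b) * x = 0 := fun x => by
    rw [sub_mul, (Θ.toHom φ).central, ← fst_mul, ← fst_mul', sub_self]
  have := h (star ((Θ.toHom φ).snd b - (Θ.toHom φ).fst b))
  rwa [CStarRing.mul_star_self_eq_zero_iff, sub_eq_zero] at this

theorem star_fst (φ : C₀(T, ℂ)) (b : B) :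
    star ((Θ.toHom φ).fst b) = (Θ.toHom (star φ)).fst (star b) := by
  rw [map_star Θ.toHom, DoubleCentralizer.star_fst, star_star, snd_eq_fst]

theorem mul_mem_left {t : T} (b : B) {x : B} (hx : x ∈ Θ.fibreIdeal t) :
    b * x ∈ Θ.fibreIdeal t := by
  refine map_mem_closure (f := fun x => b * x) (by fun_prop) hx fun y hy => ?_
  refine Submodule.span_induction (p := fun y _ => b * y ∈ Submodule.span ℂ
    {x : B | ∃ (φ : C₀(T, ℂ)) (b : B), φ t = 0 ∧ x = (Θ.toHom φ).fst b}) ?_ ?_ ?_ ?_ hy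
  · rintro _ ⟨φ, c, h, rfl⟩
    exact Submodule.subset_span ⟨φ, b * c, h, (Θ.fst_mul φ b c).symm⟩
  · simp
  · intro x y _ _ hx hy
    rw [mul_add]
    exact add_mem hx hy
  · intro k x _ hx
    rw [mul_smul_comm]
    exact Submodule.smul_mem _ _ hx

theorem mul_mem_right {t : T} (b : B) {x : B} (hx : x ∈ Θ.fibreIdeal t) :
    x * b ∈ Θ.fibreIdeal t := by
  refine map_mem_closure (f := fun x => x * b) (by fun_prop) hx fun y hy => ?_
  refine Submodule.span_induction (p := fun y _ => y * b ∈ Submodule.span ℂ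
    {x : B | ∃ (φ : C₀(T, ℂ)) (b : B), φ t = 0 ∧ x = (Θ.toHom φ).fst b}) ?_ ?_ ?_ ?_ hy
  · rintro _ ⟨φ, c, h, rfl⟩
    exact Submodule.subset_span ⟨φ, c * b, h, (Θ.fst_mul' φ c b).symm⟩
  · simp
  · intro x y _ _ hx hy
    rw [add_mul]
    exact add_mem hx hy
  · intro k x _ hx
    rw [smul_mul_assoc]
    exact Submodule.smul_mem _ _ hx

theorem star_mem {t : T} {x : B} (hx : x ∈ Θ.fibreIdeal t) : star x ∈ Θ.fibreIdeal t := by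
  refine map_mem_closure (f := fun x => star x) continuous_star hx fun y hy => ?_
  refine Submodule.span_induction (p := fun y _ => star y ∈ Submodule.span ℂ
    {x : B | ∃ (φ : C₀(T, ℂ)) (b : B), φ t = 0 ∧ x = (Θ.toHom φ).fst b}) ?_ ?_ ?_ ?_ hy
  · rintro _ ⟨φ, c, h, rfl⟩
    exact Submodule.subset_span ⟨star φ, star c, by simp [h], Θ.star_fst φ c⟩
  · simp
  · intro x y _ _ hx hy
    rw [star_add]
    exact add_mem hx hy
  · intro k x _ hx
    rw [star_smul]
    exact Submodule.smul_mem _ _ hx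

/-- The fibre `B(t) = B / I_t`, with the quotient norm and the quotient operations. -/
def Fibre (t : T) : Type _ := B ⧸ Θ.fibreIdeal t

/-- The quotient map `b ↦ b(t)` from `B` to the fibre. -/
def toFibre (t : T) (b : B) : Θ.Fibre t := (Θ.fibreIdeal t).mkQ b

instance (t : T) : IsClosed (Θ.fibreIdeal t : Set B) := Submodule.isClosed_topologicalClosure _

instance (t : T) : NormedAddCommGroup (Θ.Fibre t) :=
  inferInstanceAs (NormedAddCommGroup (B ⧸ Θ.fibreIdeal t))

instance (t : T) : NormedSpace ℂ (Θ.Fibre t) :=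
  inferInstanceAs (NormedSpace ℂ (B ⧸ Θ.fibreIdeal t))

/-- The product of the fibre, `a(t) b(t) = (a b)(t)`. -/
instance (t : T) : Mul (Θ.Fibre t) :=
  ⟨Quotient.map₂ (sa := (Θ.fibreIdeal t).quotientRel) (sb := (Θ.fibreIdeal t).quotientRel)
    (sc := (Θ.fibreIdeal t).quotientRel) (fun a b => a * b) fun a a' ha b b' hb => by
      rw [← Quotient.eq_iff_equiv] at ha hb ⊢
      rw [Quotient.eq, Submodule.quotientRel_def] at ha hb ⊢
      have : a * b - a' * b' = (a - a') * b + a' * (b - b') := by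
        rw [sub_mul, mul_sub]; abel
      rw [this]
      exact add_mem (Θ.mul_mem_right _ ha) (Θ.mul_mem_left _ hb)⟩

/-- The involution of the fibre, `b(t)* = (b*)(t)`. -/
instance (t : T) : Star (Θ.Fibre t) :=
  ⟨Quotient.map (sa := (Θ.fibreIdeal t).quotientRel) (sb := (Θ.fibreIdeal t).quotientRel)
    (fun a => star a) fun a a' ha => by
      rw [← Quotient.eq_iff_equiv] at ha ⊢
      rw [Quotient.eq, Submodule.quotientRel_def] at ha ⊢
      rw [← star_sub]
      exact Θ.star_mem ha⟩

theorem toFibre_mul (t : T) (a b : B) : Θ.toFibre t (a * b) = Θ.toFibre t a * Θ.toFibre t b := rfl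

theorem toFibre_star (t : T) (a : B) : Θ.toFibre t (star a) = star (Θ.toFibre t a) := rfl

end C0Algebra

end

/-! The whole theorem rests on two facts about evaluation at `u`: the quotient norm of the class of
`f` in the fibre over `E · u` equals `‖f u‖`, and `f ↦ f u` maps the induced algebra onto `A u`.

The norm identity (`norm_toFibre_ind`) is a cut-off argument. An equivariant section has constant
norm on orbits, and the orbits where `‖f‖ ≥ ‖f u‖ + ε` form a compact set that misses `E · u`. A
function `φ` equal to `1` there and to `0` at `E · u` shows that `f`, modulo the fibre ideal, has a
representative of norm at most `‖f u‖ + ε`. The reverse inequality holds because the ideal vanishes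
at `u`. Urysohn functions are available because the Haar system makes `r`, hence the orbit map,
open, while properness closes the orbit relation: the orbit space is locally compact Hausdorff.

Surjectivity (`evalHom_surjective`) is the hard part. By principality there is exactly one arrow
between two points of an orbit, so all fibres over an orbit are canonically identified, and the
total space of the bundle can be divided by the action. Properness and principality force arrows
between points near `x` to be near the unit at `x`; hence the topology upstairs can be recovered
locally from the quotient (`eventually_of_totMap`), the quotient is again an upper semicontinuous
bundle, and its continuous sections lift to continuous equivariant sections. A bundle over a locally
compact Hausdorff base has enough sections (`exists_section_near`), so evaluation has dense range;
the cut-off argument lifts values with norm control, so the range is closed.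

Restriction to an orbit reduces to evaluation: an equivariant section over a single orbit is
determined by its value at `u`, with the same norm. Orbits are closed and invariant, so the Haar
system restricts as well. -/

open Topology Filter Set MeasureTheory
open scoped ENNReal ZeroAtInfty MultiplierAlgebra

noncomputable section

/-! ### Neighbourhoods in the total space of a bundle -/

namespace USCBundle

variable {T : Type*} [TopologicalSpace T] {A : T → Type*} [∀ t, NonUnitalCStarAlgebra (A t)]
  (B : USCBundle A)

/-- The neighbourhood filter of the point `a ∈ A t` of the total space. -/
def nhdsAt (t : T) (a : A t) : Filter (Tot A) := @nhds _ B.top ⟨t, a⟩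

variable {B} in
theorem eventually_nhdsAt_self {t : T} {a : A t} {p : Tot A → Prop}
    (h : ∀ᶠ z in B.nhdsAt t a, p z) : p ⟨t, a⟩ :=
  letI := B.top
  Eventually.self_of_nhds h

variable {B} in
theorem eventually_nhdsAt_eventually {t : T} {a : A t} {p : Tot A → Prop}
    (h : ∀ᶠ z in B.nhdsAt t a, p z) :
    ∀ᶠ z in B.nhdsAt t a, ∀ᶠ w in B.nhdsAt z.proj z.snd, p w :=
  letI := B.top
  eventually_eventually_nhds.2 h

theorem tendsto_proj (t : T) (a : A t) :
    Tendsto (fun z : Tot A => z.proj) (B.nhdsAt t a) (𝓝 t) :=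
  letI := B.top
  B.continuous_proj.tendsto (⟨t, a⟩ : Tot A)

variable {B} in
theorem eventually_exists_lift {t : T} {a : A t} {p : Tot A → Prop}
    (h : ∀ᶠ z in B.nhdsAt t a, p z) : ∀ᶠ y in 𝓝 t, ∃ b : A y, p ⟨y, b⟩ := by
  let := B.top
  have h1 : (fun z : Tot A => z.proj) '' {z | p z} ∈ 𝓝 t :=
    B.isOpenMap_proj.image_mem_nhds (x := (⟨t, a⟩ : Tot A)) h
  filter_upwards [h1]
  rintro _ ⟨z, hz, rfl⟩
  exact ⟨z.snd, hz⟩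

theorem eventually_norm_lt {t : T} {a : A t} {c : ℝ} (h : ‖a‖ < c) :
    ∀ᶠ z in B.nhdsAt t a, ‖z.snd‖ < c :=
  letI := B.top
  B.upperSemicontinuous_norm (⟨t, a⟩ : Tot A) c h

variable {B} in
theorem eventually_add {t : T} {a b : A t} {p : Tot A → Prop}
    (h : ∀ᶠ z in B.nhdsAt t (a + b), p z) :
    ∃ U ∈ B.nhdsAt t a, ∃ V ∈ B.nhdsAt t b, ∀ y (a' b' : A y), (⟨y, a'⟩ : Tot A) ∈ U →
      (⟨y, b'⟩ : Tot A) ∈ V → p ⟨y, a' + b'⟩ := by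
  let := B.top
  let := fibredProductTopology A B.top
  have h1 := (B.continuous_add.tendsto (⟨t, (a, b)⟩ : Tot₂ A)).eventually h
  rw [nhds_induced, eventually_comap, nhds_prod_eq, eventually_prod_iff] at h1
  obtain ⟨pa, ha, pb, hb, H⟩ := h1
  exact ⟨_, ha, _, hb, fun y a' b' h1 h2 => H h1 h2 ⟨y, (a', b')⟩ rfl⟩

theorem eventually_norm_sub_lt {t : T} {a b : A t} {c : ℝ} (h : ‖a - b‖ < c) :
    ∃ U ∈ B.nhdsAt t a, ∃ V ∈ B.nhdsAt t b, ∀ y (a' b' : A y), (⟨y, a'⟩ : Tot A) ∈ U →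
      (⟨y, b'⟩ : Tot A) ∈ V → ‖a' - b'‖ < c := by
  let := B.top
  have e : a + (-1 : ℂ) • b = a - b := by simp [sub_eq_add_neg]
  have h1 := B.eventually_norm_lt (a := a + (-1 : ℂ) • b) (c := c) (by rwa [e])
  obtain ⟨U, hU, V, hV, H⟩ := eventually_add h1
  refine ⟨U, hU, _, ((B.continuous_smul (-1)).tendsto (⟨t, b⟩ : Tot A)) hV,
    fun y a' b' h1 h2 => ?_⟩
  simpa [sub_eq_add_neg] using H y a' _ h1 h2

-- The zero axiom, applied to the coarsest filter along which norms tend to `0` and base points to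
-- `t`: neighbourhoods of `0` over `t` contain tubes.
variable {B} in
theorem eventually_zero {t : T} {p : Tot A → Prop} (h : ∀ᶠ z in B.nhdsAt t (0 : A t), p z) :
    ∃ δ > 0, ∀ᶠ y in 𝓝 t, ∀ b : A y, ‖b‖ < δ → p ⟨y, b⟩ := by
  let := B.top
  have h1 := B.tendsto_zero t
    (comap (fun z : Tot A => ‖z.snd‖) (𝓝 0) ⊓ comap (fun z : Tot A => z.proj) (𝓝 t))
    (tendsto_comap.mono_left inf_le_left) (tendsto_comap.mono_left inf_le_right)
  have h2 := h1.eventually h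
  rw [Filter.eventually_inf] at h2
  obtain ⟨s, hs, u, hu, H⟩ := h2
  obtain ⟨s', hs', hs''⟩ := mem_comap.1 hs
  obtain ⟨u', hu', hu''⟩ := mem_comap.1 hu
  obtain ⟨δ, hδ, hb⟩ := Metric.mem_nhds_iff.1 hs'
  refine ⟨δ, hδ, ?_⟩
  filter_upwards [hu'] with y hy b hb'
  exact H ⟨y, b⟩ ⟨hs'' (hb (by simpa using hb')), hu'' hy⟩

/-- Multiplication by a continuous function is continuous on the total space. -/
theorem tendsto_fun_smul {φ : T → ℂ} {t : T} (hφ : ContinuousAt φ t) (a : A t) :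
    Tendsto (fun z : Tot A => (⟨z.proj, φ z.proj • z.snd⟩ : Tot A)) (B.nhdsAt t a)
      (B.nhdsAt t (φ t • a)) := by
  let := B.top
  intro S hS
  -- Split `φ(y) z = φ(t) z + (φ(y) - φ(t)) z`: the first summand is near `φ(t) a` by continuity of
  -- a fixed scalar, the second lies in a tube around zero.
  have hS' : ∀ᶠ z in B.nhdsAt t (φ t • a + 0), z ∈ S := by simpa using hS
  obtain ⟨U, hU, V, hV, H⟩ := eventually_add hS'
  obtain ⟨δ, hδ, hV'⟩ := eventually_zero hV
  have h1 := ((B.continuous_smul (φ t)).tendsto (⟨t, a⟩ : Tot A)).eventually hU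
  have h2 := B.eventually_norm_lt (lt_add_one ‖a‖)
  have h3 : ∀ᶠ y in 𝓝 t, ‖φ y - φ t‖ < δ / (‖a‖ + 1) := by
    have := Metric.tendsto_nhds.1 hφ (δ / (‖a‖ + 1)) (by positivity)
    simpa [dist_eq_norm] using this
  rw [mem_map]
  filter_upwards [h1, h2, (B.tendsto_proj t a).eventually h3, (B.tendsto_proj t a).eventually hV']
    with z z1 z2 z3 z4
  have := H z.proj (φ t • z.snd) ((φ z.proj - φ t) • z.snd) z1 (z4 _ ?_)
  · simpa [sub_smul] using this
  · rw [norm_smul]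
    rw [lt_div_iff₀ (by positivity)] at z3
    exact lt_of_le_of_lt (mul_le_mul_of_nonneg_left z2.le (norm_nonneg _)) z3

theorem IsContinuousSection.fun_smul {f : ∀ t, A t} (hf : B.IsContinuousSection f) {φ : T → ℂ}
    (hφ : Continuous φ) : B.IsContinuousSection fun t => φ t • f t := by
  rw [isContinuousSection_iff] at hf ⊢
  exact fun t => (B.tendsto_fun_smul hφ.continuousAt (f t)).comp (hf t)

/-! ### Sections of small oscillation -/

/-- A section `f` whose oscillation at `t`, measured by nearby points of the total space, is at
most `ε`. -/
def NearCont (ε : ℝ) (f : ∀ t, A t) (t : T) : Prop :=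
  ∀ δ > ε, ∀ᶠ z in B.nhdsAt t (f t), ‖f z.proj - z.snd‖ < δ

variable {B}

theorem NearCont.mono {ε ε' : ℝ} {f : ∀ t, A t} {t : T} (h : B.NearCont ε f t) (hε : ε ≤ ε') :
    B.NearCont ε' f t := fun δ hδ => h δ (hε.trans_lt hδ)

/-- The estimate transfers from the point `f t` to any other point `b` of the fibre. Since the
projection is open, every nearby base point carries a lift `w` close to `f t`, and the triangle
inequality passes through `w`. -/
theorem NearCont.eventually {ε : ℝ} {f : ∀ t, A t} {t : T} (h : B.NearCont ε f t) (b : A t)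
    {δ : ℝ} (hδ : ε + ‖f t - b‖ < δ) : ∀ᶠ z in B.nhdsAt t b, ‖f z.proj - z.snd‖ < δ := by
  set κ := (δ - (ε + ‖f t - b‖)) / 2 with hκ
  have h1 := h (ε + κ) (by linarith)
  obtain ⟨U, hU, V, hV, H⟩ := B.eventually_norm_sub_lt (a := f t) (b := b) (c := ‖f t - b‖ + κ)
    (by linarith)
  have h2 := eventually_exists_lift (h1.and hU)
  filter_upwards [hV, (B.tendsto_proj t b).eventually h2]
  rintro z hz ⟨w, hw1, hw2⟩
  have := H _ w z.snd hw2 hz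
  have e : f z.proj - z.snd = (f z.proj - w) + (w - z.snd) := by abel
  rw [e]
  refine (norm_add_le _ _).trans_lt ?_
  linarith

/-- For `z` near `f t + g t`, pick a lift `w` near `f t` over the same base point; then `z - w` is
near `g t`, so the two oscillations add. -/
theorem NearCont.add {ε ε' : ℝ} {f g : ∀ t, A t} {t : T} (hf : B.NearCont ε f t)
    (hg : B.NearCont ε' g t) : B.NearCont (ε + ε') (f + g) t := by
  intro δ hδ
  let := B.top
  have h1 := hf (ε + (δ - (ε + ε')) / 2) (by linarith)
  have h2 := hg (ε' + (δ - (ε + ε')) / 2) (by linarith)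
  have e : (f + g) t + (-1 : ℂ) • f t = g t := by simp
  have h2' : ∀ᶠ z in B.nhdsAt t ((f + g) t + (-1 : ℂ) • f t),
    ‖g z.proj - z.snd‖ < ε' + (δ - (ε + ε')) / 2 := by rwa [e]
  obtain ⟨U, hU, V, hV, H⟩ := eventually_add h2'
  have hV' := ((B.continuous_smul (-1)).tendsto (⟨t, f t⟩ : Tot A)) hV
  have h3 := eventually_exists_lift (h1.and hV')
  filter_upwards [hU, (B.tendsto_proj t _).eventually h3]
  rintro z hz ⟨w, hw1, hw2⟩
  have h4 := H _ z.snd _ hz hw2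
  have e : (f + g) z.proj - z.snd = (f z.proj - w) + (g z.proj - (z.snd + (-1 : ℂ) • w)) := by
    simp only [Pi.add_apply, neg_smul, one_smul]; abel
  rw [e]
  refine (norm_add_le _ _).trans_lt ?_
  simp only at hw1 h4
  linarith

theorem nearCont_zero (t : T) : B.NearCont 0 (0 : ∀ t, A t) t := fun δ hδ => by
  filter_upwards [B.eventually_norm_lt (t := t) (a := 0) (c := δ) (by simpa using hδ)] with z hz
  simpa using hz

theorem NearCont.sum {ι : Type*} (s : Finset ι) {ε : ι → ℝ} {f : ι → ∀ t, A t} {t : T}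
    (h : ∀ i ∈ s, B.NearCont (ε i) (f i) t) : B.NearCont (∑ i ∈ s, ε i) (∑ i ∈ s, f i) t := by
  classical
  induction s using Finset.induction_on with
  | empty => simpa using nearCont_zero t
  | insert i s hi ih =>
    rw [Finset.sum_insert hi, Finset.sum_insert hi]
    exact (h i (by simp)).add (ih fun j hj => h j (by simp [hj]))

theorem NearCont.fun_smul {ε : ℝ} {f : ∀ t, A t} {t : T} (hf : B.NearCont ε f t) {φ : T → ℂ}
    (hφ : ContinuousAt φ t) : B.NearCont (‖φ t‖ * ε) (fun y => φ y • f y) t := by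
  intro δ hδ
  set κ := δ - ‖φ t‖ * ε with hκ
  have hκ0 : 0 < κ := by linarith
  -- Half of the slack `κ` pays for the oscillation of `f` and the variation of `φ`, the other half
  -- for the distance from `φ • w` to `z`.
  obtain ⟨η, hη, hη'⟩ : ∃ η > 0, ‖φ t‖ * (ε + η) < ‖φ t‖ * ε + κ / 2 := by
    refine ⟨κ / 2 / (‖φ t‖ + 1), by positivity, ?_⟩
    rw [mul_add, add_lt_add_iff_left, mul_div_assoc', div_lt_iff₀ (by positivity)]
    nlinarith [norm_nonneg (φ t)]
  have h1 := hf (ε + η) (by linarith)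
  have h0 : ∀ᶠ y in 𝓝 t, ‖φ y‖ * (ε + η) < ‖φ t‖ * ε + κ / 2 :=
    ((hφ.norm.mul_const (ε + η))).eventually (gt_mem_nhds hη')
  obtain ⟨U, hU, V, hV, H⟩ := B.eventually_norm_sub_lt (a := φ t • f t) (b := φ t • f t)
    (c := κ / 2) (by simpa using hκ0)
  have h2 := eventually_exists_lift (h1.and ((B.tendsto_fun_smul hφ (f t)) hU))
  filter_upwards [hV, (B.tendsto_proj t _).eventually h2, (B.tendsto_proj t _).eventually h0]
  rintro z hz ⟨w, hw1, hw2⟩ h0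
  have h4 := H _ _ z.snd hw2 hz
  have e : φ z.proj • f z.proj - z.snd =
      φ z.proj • (f z.proj - w) + (φ z.proj • w - z.snd) := by rw [smul_sub]; abel
  rw [e]
  refine (norm_add_le _ _).trans_lt ?_
  rw [norm_smul]
  have := mul_le_mul_of_nonneg_left hw1.le (norm_nonneg (φ z.proj))
  linarith

theorem NearCont.congr {ε : ℝ} {f g : ∀ t, A t} {t : T} (hf : B.NearCont ε f t)
    (h : ∀ᶠ y in 𝓝 t, f y = g y) : B.NearCont ε g t := by
  intro δ hδ
  have := hf δ hδ
  rw [h.self_of_nhds] at this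
  filter_upwards [this, (B.tendsto_proj t _).eventually h] with z h1 h2
  rwa [← h2]

/-- Write `f y = (f y - b) + b` with `b` near `f t`; the difference is small in norm, hence near
zero in the total space, and addition is continuous. -/
theorem isContinuousSection_of_nearCont {f : ∀ t, A t} (h : ∀ t, B.NearCont 0 f t) :
    B.IsContinuousSection f := by
  rw [isContinuousSection_iff]
  intro t S hS
  have hS' : ∀ᶠ z in B.nhdsAt t (0 + f t), z ∈ S := by rw [zero_add]; exact hS
  obtain ⟨U, hU, V, hV, H⟩ := eventually_add hS'
  obtain ⟨δ, hδ, hU'⟩ := eventually_zero hU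
  rw [mem_map]
  filter_upwards [eventually_exists_lift ((h t δ hδ).and hV), hU']
  rintro y ⟨b, hb1, hb2⟩ hy
  simpa using H y (f y - b) b (hy _ hb1) hb2

theorem nearCont_of_approx {f : ∀ t, A t} {t : T}
    (h : ∀ η > 0, ∃ g : ∀ t, A t, B.NearCont η g t ∧ ∀ y, ‖f y - g y‖ ≤ η) :
    B.NearCont 0 f t := by
  intro δ hδ
  obtain ⟨g, hg, hfg⟩ := h (δ / 4) (by linarith)
  have := hfg t
  rw [norm_sub_rev] at this
  -- Oscillation `δ/4` of `g` plus `‖g t - f t‖ ≤ δ/4` is below `3δ/4`; the remaining `δ/4` covers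
  -- `‖f - g‖` at the nearby point.
  filter_upwards [hg.eventually (f t) (δ := 3 / 4 * δ) (by linarith)] with z hz
  have e : f z.proj - z.snd = (f z.proj - g z.proj) + (g z.proj - z.snd) := by abel
  rw [e]
  refine (norm_add_le _ _).trans_lt ?_
  have := hfg z.proj
  linarith

/-- Through every point of the total space there is a section with small oscillation near the
base point. -/
theorem exists_nearCont {t : T} (a : A t) {ε : ℝ} (hε : 0 < ε) {p : Tot A → Prop}
    (hp : ∀ᶠ z in B.nhdsAt t a, p z) :
    ∃ h : ∀ t, A t, h t = a ∧ ∀ᶠ y in 𝓝 t, B.NearCont ε h y ∧ p ⟨y, h y⟩ := by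
  classical
  -- Since `a - a = 0`, upper semicontinuity of the norm makes any two points over the same base
  -- point, both close to `a`, differ by less than `ε`.
  obtain ⟨U, hU, V, hV, H⟩ := B.eventually_norm_sub_lt (a := a) (b := a) (c := ε) (by simpa)
  set q : Tot A → Prop := fun z => z ∈ U ∧ z ∈ V ∧ p z
  have hq : ∀ᶠ z in B.nhdsAt t a, q z := (show ∀ᶠ z in _, z ∈ U from hU).and
    ((show ∀ᶠ z in _, z ∈ V from hV).and hp)
  have hq' := eventually_nhdsAt_eventually hq
  have h1 := eventually_exists_lift hq'
  -- The value over `y` is chosen so that `q` holds on a whole neighbourhood of it, whenever such a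
  -- value exists; it is `a` at `t`, and `0` is only a default. Nearby values of `h` and nearby
  -- points of the total space then both satisfy `q`.
  have h2 : ∀ y, ∃ b : A y, (∀ hy : y = t, b = hy ▸ a) ∧
      ((∃ b : A y, ∀ᶠ w in B.nhdsAt y b, q w) → ∀ᶠ w in B.nhdsAt y b, q w) := by
    intro y
    by_cases hy : y = t
    · subst hy
      exact ⟨a, fun _ => rfl, fun _ => hq⟩
    · by_cases hb : ∃ b : A y, ∀ᶠ w in B.nhdsAt y b, q w
      · obtain ⟨b, hb⟩ := hb
        exact ⟨b, fun h => (hy h).elim, fun _ => hb⟩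
      · exact ⟨0, fun h => (hy h).elim, fun h => (hb h).elim⟩
  choose h ha hh using h2
  refine ⟨h, ha t rfl, ?_⟩
  filter_upwards [h1, h1.eventually_nhds] with y hy hy'
  have hy1 := hh y hy
  refine ⟨fun δ hδ => ?_, (eventually_nhdsAt_self hy1).2.2⟩
  filter_upwards [hy1, (B.tendsto_proj y _).eventually hy'] with z hz hz'
  exact (H _ _ _ (eventually_nhdsAt_self (hh z.proj hz')).1 hz.2.1).trans hδ

/-! ### Enough continuous sections over a locally compact base -/

section LocallyCompact

variable [LocallyCompactSpace T] [T2Space T]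

/-- The improvement step: through each `f t` there is a section of oscillation `ε'` which, as `f`
oscillates by at most `ε`, stays within `2 * ε` of `f` near `t`. A partition of unity on `K` glues
finitely many of them, and both bounds survive convex combination. -/
theorem exists_nearCont_refine {K : Set T} (hK : IsCompact K) {ε ε' : ℝ} (hε : 0 < ε)
    (hε' : 0 < ε') {f : ∀ t, A t} (hf : ∀ t ∈ K, B.NearCont ε f t) :
    ∃ g : ∀ t, A t, (∀ t ∈ K, B.NearCont ε' g t) ∧ ∀ t ∈ K, ‖g t - f t‖ ≤ 2 * ε := by
  have h1 : ∀ t ∈ K, ∃ h : ∀ t, A t, ∃ U : Set T, IsOpen U ∧ t ∈ U ∧ ∀ y ∈ U,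
      B.NearCont ε' h y ∧ ‖f y - h y‖ < 2 * ε := by
    intro t ht
    obtain ⟨h, -, hh⟩ := exists_nearCont (f t) hε' (hf t ht (2 * ε) (by linarith))
    obtain ⟨U, hU, ho, htU⟩ := eventually_nhds_iff.1 hh
    exact ⟨h, U, ho, htU, hU⟩
  choose! h U hU htU hh using h1
  obtain ⟨s, hs, hsK⟩ := hK.elim_nhds_subcover U fun t ht => (hU t ht).mem_nhds (htU t ht)
  let e := s.equivFin
  obtain ⟨φ, hφ1, hφ2, hφ3, -⟩ := exists_continuous_sum_one_of_isOpen_isCompact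
    (s := fun i => U (e.symm i)) (fun i => hU _ (hs _ (e.symm i).2)) hK (by
      intro t ht
      obtain ⟨x, hx, hxt⟩ := mem_iUnion₂.1 (hsK ht)
      exact mem_iUnion.2 ⟨e ⟨x, hx⟩, by simpa using hxt⟩)
  have hsum : ∀ t ∈ K, ∑ i, φ i t = 1 := fun t ht => by simpa using hφ2 ht
  have hn : ∀ i t, ‖((φ i t : ℝ) : ℂ)‖ = φ i t := fun i t => by
    rw [Complex.norm_real, Real.norm_of_nonneg (hφ3 i t).1]
  refine ⟨∑ i, fun t => ((φ i t : ℝ) : ℂ) • h (e.symm i) t, fun t ht => ?_, fun t ht => ?_⟩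
  · have : B.NearCont (∑ i, φ i t * ε') (∑ i, fun t => ((φ i t : ℝ) : ℂ) • h (e.symm i) t) t := by
      refine NearCont.sum _ fun i _ => ?_
      have hc : Continuous fun t => ((φ i t : ℝ) : ℂ) :=
        Complex.continuous_ofReal.comp (φ i).continuous
      by_cases hi : t ∈ U (e.symm i)
      · have := (hh _ (hs _ (e.symm i).2) t hi).1.fun_smul hc.continuousAt
        rwa [hn] at this
      -- Outside the patch `h` is uncontrolled, but there the summand vanishes in a neighbourhood,
      -- so its oscillation is `0 = φ i t * ε'`.
      · have hi' := fun h' => hi (hφ1 i h')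
        have h0 : φ i t = 0 := image_eq_zero_of_notMem_tsupport hi'
        rw [h0, zero_mul]
        refine (nearCont_zero t).congr ?_
        filter_upwards [(isClosed_tsupport (φ i)).isOpen_compl.mem_nhds hi'] with y hy
        simp [image_eq_zero_of_notMem_tsupport hy]
    rwa [← Finset.sum_mul, hsum t ht, one_mul] at this
  · have e1 : f t = ∑ i, ((φ i t : ℝ) : ℂ) • f t := by
      rw [← Finset.sum_smul, ← Complex.ofReal_sum, hsum t ht, Complex.ofReal_one, one_smul]
    rw [Finset.sum_apply, e1, ← Finset.sum_sub_distrib]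
    calc _ ≤ ∑ i, φ i t * (2 * ε) := by
          refine norm_sum_le_of_le _ fun i _ => ?_
          rw [← smul_sub, norm_smul, hn]
          by_cases hi : t ∈ U (e.symm i)
          · refine mul_le_mul_of_nonneg_left ?_ (hφ3 i t).1
            rw [norm_sub_rev]
            exact (hh _ (hs _ (e.symm i).2) t hi).2.le
          · rw [image_eq_zero_of_notMem_tsupport fun h' => hi (hφ1 i h')]
            simp
      _ = 2 * ε := by rw [← Finset.sum_mul, hsum t ht, one_mul]

theorem exists_seq_nearCont {K : Set T} (hK : IsCompact K) {ε : ℝ} (hε : 0 < ε) {f : ∀ t, A t}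
    (hf : ∀ t ∈ K, B.NearCont ε f t) :
    ∃ g : ℕ → ∀ t, A t, g 0 = f ∧ ∀ n, ∀ t ∈ K, B.NearCont (ε / 2 ^ n) (g n) t ∧
      ‖g (n + 1) t - g n t‖ ≤ 2 * (ε / 2 ^ n) := by
  choose! F hF1 hF2 using fun (n : ℕ) (f : ∀ t, A t) (hf : ∀ t ∈ K, B.NearCont (ε / 2 ^ n) f t) =>
    exists_nearCont_refine hK (ε' := ε / 2 ^ (n + 1)) (by positivity) (by positivity) hf
  let g : ℕ → ∀ t, A t := fun n => Nat.rec f (fun n f => F n f) n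
  have hg : ∀ n, ∀ t ∈ K, B.NearCont (ε / 2 ^ n) (g n) t := by
    intro n
    induction n with
    | zero => simpa [g] using hf
    | succ n ih => exact hF1 n _ ih
  exact ⟨g, rfl, fun n t ht => ⟨hg n t ht, hF2 n _ (hg n) t ht⟩⟩

/-- An upper semicontinuous bundle over a locally compact Hausdorff space has enough sections: the
values at `t` of the compactly supported continuous sections are dense in the fibre. -/
theorem exists_section_near (t : T) (a : A t) {ε : ℝ} (hε : 0 < ε) :
    ∃ f : ∀ t, A t, B.IsContinuousSection f ∧ ‖f t - a‖ ≤ ε ∧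
      ∃ K, IsCompact K ∧ ∀ y ∉ K, f y = 0 := by
  -- Starting from `ε / 4`, the successive corrections are at most `2 * (ε / 4) / 2 ^ n`, which sum
  -- to `ε`.
  obtain ⟨h, rfl, hh⟩ := exists_nearCont (B := B) a (show 0 < ε / 4 by positivity)
    (Eventually.of_forall fun _ => trivial)
  obtain ⟨K, hK, hKU, hKc⟩ := local_compact_nhds hh
  obtain ⟨g, hg0, hg⟩ := exists_seq_nearCont hKc (show 0 < ε / 4 by positivity)
    fun t ht => (hKU ht).1
  have hd : ∀ y ∈ K, ∀ n, dist (g n y) (g (n + 1) y) ≤ ε / 2 / 2 ^ n := fun y hy n => by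
    rw [dist_comm, dist_eq_norm]
    refine ((hg n y hy).2).trans (le_of_eq ?_)
    ring
  have hlim : ∀ y ∈ K, ∃ b : A y, Tendsto (fun n => g n y) atTop (𝓝 b) := fun y hy =>
    cauchySeq_tendsto_of_complete (cauchySeq_of_le_geometric (1 / 2) (ε / 2) (by norm_num)
      fun n => (hd y hy n).trans (le_of_eq (by rw [one_div, inv_pow]; rfl)))
  choose! F hF using hlim
  have hgF : ∀ y ∈ K, ∀ n, ‖F y - g n y‖ ≤ ε / 2 ^ n := fun y hy n => by
    have := dist_le_of_le_geometric_two_of_tendsto (C := ε) (fun n => (hd y hy n)) (hF y hy) n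
    rwa [dist_comm, dist_eq_norm] at this
  -- The limit is controlled only on `K`; the cut-off makes it a global section, equal to the limit
  -- at `t` and zero off `K`.
  obtain ⟨χ, hχ1, hχ0, -, hχ⟩ := exists_continuous_one_zero_of_isCompact (isCompact_singleton (x := t))
    (isOpen_interior (s := interior K)).isClosed_compl
    (by simpa [disjoint_compl_right_iff_subset] using mem_interior_iff_mem_nhds.2 hK)
  have hχc : Continuous fun y => ((χ y : ℝ) : ℂ) := Complex.continuous_ofReal.comp χ.continuous
  have hχn : ∀ y, ‖((χ y : ℝ) : ℂ)‖ ≤ 1 := fun y => by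
    rw [Complex.norm_real, Real.norm_of_nonneg (hχ y).1]; exact (hχ y).2
  have hχK : ∀ y ∉ K, χ y = 0 := fun y hy => hχ0 fun h => hy (interior_subset (interior_subset h))
  refine ⟨fun y => ((χ y : ℝ) : ℂ) • F y, ?_, ?_, K, hKc, fun y hy => by simp [hχK y hy]⟩
  · refine isContinuousSection_of_nearCont fun y => ?_
    refine nearCont_of_approx fun η hη => ?_
    obtain ⟨n, hn⟩ : ∃ n : ℕ, ε / 2 ^ n < η := by
      have : Tendsto (fun n : ℕ => ε / 2 ^ n) atTop (𝓝 0) :=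
        tendsto_const_nhds.div_atTop (tendsto_pow_atTop_atTop_of_one_lt (by norm_num))
      exact (this.eventually (gt_mem_nhds hη)).exists
    refine ⟨fun y => ((χ y : ℝ) : ℂ) • g n y, ?_, fun y => ?_⟩
    · by_cases hy : y ∈ K
      · refine ((hg n y hy).1.fun_smul hχc.continuousAt).mono ?_
        have : ε / 4 / 2 ^ n ≤ ε / 2 ^ n := by gcongr; linarith
        have h0 : 0 ≤ ε / 4 / 2 ^ n := by positivity
        nlinarith [hχn y]
      · refine ((nearCont_zero y).congr ?_).mono hη.le
        filter_upwards [hKc.isClosed.isOpen_compl.mem_nhds hy] with x hx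
        simp [hχK x hx]
    · by_cases hy : y ∈ K
      · rw [← smul_sub, norm_smul]
        have := hgF y hy n
        nlinarith [hχn y, norm_nonneg (F y - g n y), norm_nonneg ((χ y : ℝ) : ℂ)]
      · simp [hχK y hy, hη.le]
  · have h1 : χ t = 1 := hχ1 rfl
    have := hgF t (mem_of_mem_nhds hK) 0
    simpa [h1, hg0] using this

end LocallyCompact

end USCBundle

/-! ### Openness of the range map and topology of the orbit space -/

namespace TopologicalGroupoid

variable {E X : Type*} [TopologicalSpace E] [TopologicalSpace X] {G : TopologicalGroupoid E X}

theorem inv_mul_cancel_left (γ η : E) (h : G.r γ = G.r η) :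
    G.mul γ (G.mul (G.inv γ) η ((G.s_inv γ).trans h))
      ((G.r_inv γ).symm.trans (G.r_mul _ _ _).symm) = η := by
  rw [← G.mul_assoc γ (G.inv γ) η (G.r_inv γ).symm]
  -- A product carries a proof of composability, so a factor cannot be rewritten directly; it is
  -- generalised first.
  have : ∀ ζ (_ : ζ = G.unit (G.r η)) (hζ : G.s ζ = G.r η), G.mul ζ η hζ = η := by
    rintro _ rfl _
    exact G.unit_mul η
  exact this _ (by rw [G.mul_inv, h]) _

/-- The arrow `γ⁻¹ η` has equal range and source, so it is a unit. -/
theorem IsPrincipal.eq_of_r_eq_s_eq (hG : G.IsPrincipal) {γ η : E} (hr : G.r γ = G.r η)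
    (hs : G.s γ = G.s η) : γ = η := by
  have h1 := hG (G.mul (G.inv γ) η ((G.s_inv γ).trans hr)) (by
    rw [G.r_mul, G.s_mul, G.r_inv, hs])
  rw [← inv_mul_cancel_left γ η hr]
  have : ∀ ζ (_ : ζ = G.unit (G.s γ)) (hζ : G.s γ = G.r ζ), G.mul γ ζ hζ = γ := by
    rintro _ rfl _
    exact G.mul_unit γ
  refine (this _ ?_ _).symm
  rw [h1, G.s_mul, hs]

theorem inv_inv (γ : E) : G.inv (G.inv γ) = γ := by
  have h := inv_mul_cancel_left (G := G) (G.inv γ) (G.unit (G.s γ))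
    ((G.r_inv γ).trans (G.r_unit _).symm)
  have e1 : ∀ ζ (_ : ζ = G.unit (G.r γ)) (hζ : G.s ζ = G.r γ), G.mul ζ γ hζ = γ := by
    rintro _ rfl _
    exact G.unit_mul γ
  have e2 : ∀ ζ (_ : ζ = G.unit (G.s (G.inv (G.inv γ)))) (hζ : G.s (G.inv (G.inv γ)) = G.r ζ),
      G.mul (G.inv (G.inv γ)) ζ hζ = G.inv (G.inv γ) := by
    rintro _ rfl _
    exact G.mul_unit _
  have h1 : G.s (G.inv (G.inv γ)) = G.r (G.inv γ) := G.s_inv _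
  have h3 := G.mul_assoc (G.inv (G.inv γ)) (G.inv γ) γ h1 (G.s_inv γ)
  rw [e1 _ (by rw [G.inv_mul, G.s_inv]), e2 _ (by rw [G.inv_mul, h1, G.r_inv])] at h3
  exact h3.symm

theorem isOpenMap_inv : IsOpenMap G.inv :=
  (Homeomorph.mk ⟨G.inv, G.inv, inv_inv, inv_inv⟩ G.continuous_inv G.continuous_inv).isOpenMap

theorem ae_r_eq [MeasurableSpace E] [SecondCountableTopology E] (lam : G.HaarSystem) (u : X) :
    ∀ᵐ γ ∂(lam.μ u), G.r γ = u := by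
  have h : (lam.μ u).support ∈ ae (lam.μ u) := Measure.support_mem_ae
  rw [lam.support_eq] at h
  exact h

/-- The range map of a groupoid with a Haar system is open. -/
theorem isOpenMap_r [LocallyCompactSpace E] [T2Space E] [SecondCountableTopology E]
    [MeasurableSpace E] [BorelSpace E] (lam : G.HaarSystem) : IsOpenMap G.r := by
  refine IsOpenMap.of_nhds_le fun γ S hS => ?_
  have hS' : G.r ⁻¹' S ∈ 𝓝 γ := hS
  -- Take a bump `f` at `γ` that vanishes outside `r ⁻¹ S`. Its integral against `μ v` is continuous
  -- in `v` and positive at `r γ`, as `γ` lies in the support of that measure; but it vanishes for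
  -- `v ∉ S`, since `μ v` is concentrated on `r ⁻¹ {v}`.
  obtain ⟨f, hf1, hf0, hfc, hf⟩ := exists_continuous_one_zero_of_isCompact
    (isCompact_singleton (x := γ)) (isOpen_interior (s := G.r ⁻¹' S)).isClosed_compl
    (by simpa [disjoint_compl_right_iff_subset] using mem_interior_iff_mem_nhds.2 hS')
  have hγ : f γ = 1 := hf1 rfl
  have := lam.finite_on_compacts
  have hI := lam.continuous_integral (fun γ => (f γ : ℂ))
    (Complex.continuous_ofReal.comp f.continuous)
    (hfc.comp_left (g := fun x : ℝ => (x : ℂ)) Complex.ofReal_zero)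
  have hpos : 0 < ∫ η, f η ∂(lam.μ (G.r γ)) := by
    rw [integral_pos_iff_support_of_nonneg (fun η => (hf η).1)
      (f.continuous.integrable_of_hasCompactSupport hfc)]
    have h1 : γ ∈ (lam.μ (G.r γ)).support := by
      rw [lam.support_eq]
      rfl
    rw [Measure.mem_support_iff_forall] at h1
    refine h1 _ (f.continuous.isOpen_support.mem_nhds ?_)
    simp [hγ]
  have hne : ∫ η, (f η : ℂ) ∂(lam.μ (G.r γ)) ≠ 0 := by
    rw [integral_complex_ofReal]
    exact Complex.ofReal_ne_zero.2 hpos.ne'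
  filter_upwards [hI.continuousAt.eventually_ne hne] with v hv
  by_contra hvS
  refine hv (integral_eq_zero_of_ae ?_)
  filter_upwards [ae_r_eq lam v] with η hη
  have : f η = 0 := hf0 fun h => hvS (by
    rw [← hη]; exact (interior_subset h : η ∈ G.r ⁻¹' S))
  simp [this]

theorem isOpenMap_s (h : IsOpenMap G.r) : IsOpenMap G.s := by
  have : G.s = G.r ∘ G.inv := funext fun γ => (G.r_inv γ).symm
  rw [this]
  exact h.comp isOpenMap_inv

theorem isOpenMap_orbitMap (h : IsOpenMap G.r) : IsOpenMap G.orbitMap := by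
  intro U hU
  rw [← G.isQuotientMap_orbitMap.isOpen_preimage]
  convert h _ (hU.preimage G.continuous_s) using 1
  ext v
  constructor
  · rintro ⟨u, hu, huv⟩
    obtain ⟨γ, rfl, rfl⟩ := G.orbitMap_eq.1 huv
    exact ⟨γ, hu, rfl⟩
  · rintro ⟨γ, hγ, rfl⟩
    exact ⟨_, hγ, G.orbitMap_eq.2 ⟨γ, rfl, rfl⟩⟩

theorem isOpenQuotientMap_orbitMap (h : IsOpenMap G.r) : IsOpenQuotientMap G.orbitMap :=
  ⟨G.isQuotientMap_orbitMap.surjective, G.isQuotientMap_orbitMap.continuous, isOpenMap_orbitMap h⟩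

/-- A compact subset of `X × X` lies in the product of its projections, so it suffices that products
of compact sets have compact preimage. -/
theorem IsProper.isProperMap [LocallyCompactSpace X] [T2Space X] (hG : G.IsProper) :
    IsProperMap fun γ => (G.s γ, G.r γ) := by
  have hc : Continuous fun γ => (G.s γ, G.r γ) := G.continuous_s.prodMk G.continuous_r
  refine isProperMap_iff_isCompact_preimage.2 ⟨hc, fun K hK => ?_⟩
  refine (hG _ _ (hK.image continuous_fst) (hK.image continuous_snd)).of_isClosed_subset
    (hK.isClosed.preimage hc) fun γ hγ => ⟨⟨_, hγ, rfl⟩, ⟨_, hγ, rfl⟩⟩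

/-- An open quotient is Hausdorff when the relation is closed, and the orbit relation is the range
of the closed map `(s, r)`. -/
theorem IsProper.t2Space [LocallyCompactSpace X] [T2Space X] (hG : G.IsProper) (h : IsOpenMap G.r) : T2Space G.OrbitSpace := by
  rw [t2Space_iff_of_isOpenQuotientMap (isOpenQuotientMap_orbitMap h)]
  convert hG.isProperMap.isClosedMap.isClosed_range using 1
  ext ⟨u, v⟩
  simp [G.orbitMap_eq]

theorem locallyCompactSpace_orbitSpace [LocallyCompactSpace X] (h : IsOpenMap G.r) :
    LocallyCompactSpace G.OrbitSpace := by
  refine ⟨fun y n hn => ?_⟩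
  obtain ⟨x, rfl⟩ := G.isQuotientMap_orbitMap.surjective y
  obtain ⟨K, hK, hKn, hKc⟩ := local_compact_nhds
    (G.isQuotientMap_orbitMap.continuous.continuousAt hn)
  exact ⟨_, (isOpenMap_orbitMap h).image_mem_nhds hK, image_subset_iff.2 hKn,
    hKc.image G.isQuotientMap_orbitMap.continuous⟩

theorem secondCountableTopology_orbitSpace [SecondCountableTopology X] (h : IsOpenMap G.r) :
    SecondCountableTopology G.OrbitSpace :=
  G.isQuotientMap_orbitMap.secondCountableTopology (isOpenMap_orbitMap h)

/-- In a principal and proper groupoid an arrow between two points close to `x` is close to the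
unit at `x`. -/
theorem IsProper.eventually_unit [LocallyCompactSpace X] [T2Space X] (hG : G.IsProper) (hp : G.IsPrincipal) (x : X) {U : Set E}
    (hU : U ∈ 𝓝 (G.unit x)) : ∃ N ∈ 𝓝 x, ∀ γ, G.s γ ∈ N → G.r γ ∈ N → γ ∈ U := by
  have h1 := hG.isProperMap.isClosedMap _ (isOpen_interior (s := U)).isClosed_compl
  -- The only arrow from `x` to `x` is the unit, which lies in `interior U`; the image being closed,
  -- a product neighbourhood of `(x, x)` avoids it.
  have h2 : (x, x) ∉ (fun γ => (G.s γ, G.r γ)) '' (interior U)ᶜ := by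
    rintro ⟨γ, hγ, h⟩
    simp only [Prod.mk.injEq] at h
    have := hp γ (h.2.trans h.1.symm)
    rw [h.1] at this
    rw [this] at hγ
    exact hγ (mem_interior_iff_mem_nhds.2 hU)
  have h3 := h1.isOpen_compl.mem_nhds h2
  rw [nhds_prod_eq, mem_prod_same_iff] at h3
  obtain ⟨N, hN, hN'⟩ := h3
  refine ⟨N, hN, fun γ hs hr => ?_⟩
  by_contra hγ
  exact hN' (mk_mem_prod hs hr) ⟨γ, fun h => hγ (interior_subset h), rfl⟩

end TopologicalGroupoid

/-! ### The quotient bundle over the orbit space -/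

namespace GroupoidAction

variable {E X : Type*} [TopologicalSpace E] [TopologicalSpace X] {G : TopologicalGroupoid E X}
  {A : X → Type*} [∀ x, NonUnitalCStarAlgebra (A x)] {B : USCBundle A} (α : GroupoidAction G B)

/-- By principality `γ γ = γ`, so `V γ` is an idempotent bijection. -/
theorem V_self (hp : G.IsPrincipal) {γ : E} {x : X} (hs : G.s γ = x) (hr : G.r γ = x) (a : A x) :
    α.V γ hs hr a = a := by
  refine (α.V γ hs hr).injective ((α.V_mul γ γ hs hr hs hr a).trans ?_)
  congr 2
  exact hp.eq_of_r_eq_s_eq (G.r_mul _ _ _) (G.s_mul _ _ _)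

theorem V_V (hp : G.IsPrincipal) {γ η ζ : E} {x y z : X} (hx : G.s η = x) (hy : G.r η = y)
    (hy' : G.s γ = y) (hz : G.r γ = z) (hx' : G.s ζ = x) (hz' : G.r ζ = z) (a : A x) :
    α.V γ hy' hz (α.V η hx hy a) = α.V ζ hx' hz' a := by
  rw [α.V_mul]
  congr 2
  exact hp.eq_of_r_eq_s_eq ((G.r_mul _ _ _).trans (hz.trans hz'.symm))
    ((G.s_mul _ _ _).trans (hx.trans hx'.symm))

theorem eventually_V {γ₀ : E} {x y : X} (hx : G.s γ₀ = x) (hy : G.r γ₀ = y) (a : A x)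
    {p : Tot A → Prop} (h : ∀ᶠ z in B.nhdsAt y (α.V γ₀ hx hy a), p z) :
    ∃ N ∈ 𝓝 γ₀, ∃ W ∈ B.nhdsAt x a, ∀ γ ∈ N, ∀ v w (hv : G.s γ = v) (hw : G.r γ = w) (b : A v),
      (⟨v, b⟩ : Tot A) ∈ W → p ⟨w, α.V γ hv hw b⟩ := by
  subst hx hy
  let := B.top
  have h1 := (α.continuous_V.tendsto ⟨(γ₀, ⟨G.s γ₀, a⟩), rfl⟩).eventually h
  rw [nhds_subtype_eq_comap, eventually_comap, nhds_prod_eq, eventually_prod_iff] at h1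
  obtain ⟨pa, ha, pb, hb, H⟩ := h1
  refine ⟨_, ha, _, hb, ?_⟩
  rintro γ hγ _ _ rfl rfl b hb
  exact H hγ hb ⟨(γ, ⟨G.s γ, b⟩), rfl⟩ rfl

/-- A representative of an orbit. -/
def rep (y : G.OrbitSpace) : X := Quotient.out y

theorem orbitMap_rep (y : G.OrbitSpace) : G.orbitMap (rep y) = y := Quotient.out_eq y

theorem exists_arrow {v : X} {y : G.OrbitSpace} (h : G.orbitMap v = y) :
    ∃ γ, G.s γ = v ∧ G.r γ = rep y :=
  G.orbitMap_eq.1 (h.trans (orbitMap_rep y).symm)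

/-- The identification of the fibre over `v` with the fibre over the representative of its orbit. -/
def toRep (v : X) (y : G.OrbitSpace) (h : G.orbitMap v = y) : A v ≃⋆ₐ[ℂ] A (rep y) :=
  α.V (exists_arrow h).choose (exists_arrow h).choose_spec.1 (exists_arrow h).choose_spec.2

theorem norm_toRep {v : X} {y : G.OrbitSpace} (h : G.orbitMap v = y) (a : A v) :
    ‖α.toRep v y h a‖ = ‖a‖ := α.norm_V _ _ _ a

theorem norm_toRep_symm {v : X} {y : G.OrbitSpace} (h : G.orbitMap v = y) (a : A (rep y)) :
    ‖(α.toRep v y h).symm a‖ = ‖a‖ := by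
  rw [← α.norm_toRep h, StarAlgEquiv.apply_symm_apply]

theorem toRep_V (hp : G.IsPrincipal) {γ : E} {v w : X} (hs : G.s γ = v) (hr : G.r γ = w)
    {y : G.OrbitSpace} (hv : G.orbitMap v = y) (hw : G.orbitMap w = y) (a : A v) :
    α.toRep w y hw (α.V γ hs hr a) = α.toRep v y hv a :=
  α.V_V hp _ _ _ _ _ _ a

/-- The quotient map from the total space of the bundle to the total space of the quotient
bundle over the orbit space. -/
def totMap (z : Tot A) : Tot fun y : G.OrbitSpace => A (rep y) :=
  ⟨G.orbitMap z.proj, α.toRep z.proj _ rfl z.snd⟩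

theorem totMap_mk {v : X} {y : G.OrbitSpace} (h : G.orbitMap v = y) (a : A v) :
    α.totMap ⟨v, a⟩ = ⟨y, α.toRep v y h a⟩ := by
  subst h
  rfl

theorem totMap_mk_symm {v : X} {y : G.OrbitSpace} (h : G.orbitMap v = y) (a : A (rep y)) :
    α.totMap ⟨v, (α.toRep v y h).symm a⟩ = ⟨y, a⟩ := by
  rw [α.totMap_mk h, StarAlgEquiv.apply_symm_apply]

theorem totMap_surjective : Function.Surjective α.totMap := fun z =>
  ⟨_, α.totMap_mk_symm (orbitMap_rep z.proj) z.snd⟩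

theorem totMap_V (hp : G.IsPrincipal) {γ : E} {v w : X} (hs : G.s γ = v) (hr : G.r γ = w)
    (a : A v) : α.totMap ⟨w, α.V γ hs hr a⟩ = α.totMap ⟨v, a⟩ := by
  rw [α.totMap_mk rfl, α.totMap_mk (G.orbitMap_eq.2 ⟨γ, hs, hr⟩), α.toRep_V hp]

theorem exists_V_eq (hp : G.IsPrincipal) {v w : X} {a : A v} {b : A w}
    (h : α.totMap ⟨v, a⟩ = α.totMap ⟨w, b⟩) : ∃ γ, ∃ (hs : G.s γ = v) (hr : G.r γ = w),
      α.V γ hs hr a = b := by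
  obtain ⟨γ, hs, hr⟩ := G.orbitMap_eq.1
    (congrArg (fun z : Tot fun y : G.OrbitSpace => A (rep y) => z.proj) h)
  refine ⟨γ, hs, hr, ?_⟩
  rw [← α.totMap_V hp hs hr, α.totMap_mk rfl, α.totMap_mk rfl] at h
  exact (α.toRep w _ rfl).injective (by simpa using h)

/-- The quotient topology on the total space of the quotient bundle. -/
@[reducible] def quotientTop : TopologicalSpace (Tot fun y : G.OrbitSpace => A (rep y)) :=
  .coinduced α.totMap B.top

/-- The saturation of an open set is open: if `V γ` moves `b` into `U`, arrows near `γ` move points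
near `b` into `U`, and since `s` is open every base point near that of `b` is the source of such an
arrow. -/
theorem isOpenQuotientMap_totMap (hp : G.IsPrincipal) (hr : IsOpenMap G.r) :
    @IsOpenQuotientMap _ _ B.top α.quotientTop α.totMap := by
  let := B.top
  let := α.quotientTop
  have hq : IsQuotientMap α.totMap := ⟨⟨rfl⟩, α.totMap_surjective⟩
  refine .of_isOpenMap_isQuotientMap (fun U hU => ?_) hq
  rw [← hq.isOpen_preimage, isOpen_iff_mem_nhds]
  rintro ⟨w, b⟩ ⟨⟨v, a⟩, ha, h⟩
  obtain ⟨γ, hs, hr', rfl⟩ := α.exists_V_eq hp h.symm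
  obtain ⟨N, hN, W, hW, H⟩ := α.eventually_V hs hr' b (p := (· ∈ U)) (hU.mem_nhds ha)
  have h1 := (TopologicalGroupoid.isOpenMap_s hr).image_mem_nhds hN
  rw [hs] at h1
  filter_upwards [hW, (B.tendsto_proj w b).eventually h1]
  rintro ⟨w', b'⟩ hb' ⟨η, hη, hη'⟩
  exact ⟨_, H η hη _ _ hη' rfl b' hb', α.totMap_V hp _ _ _⟩

/-- The topology of the total space is determined by the projection to the base and the quotient
map to the total space of the quotient bundle. -/
theorem eventually_of_totMap [LocallyCompactSpace X] [T2Space X] (hp : G.IsPrincipal)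
    (hG : G.IsProper) (hr : IsOpenMap G.r) {x : X} {a : A x} {p : Tot A → Prop}
    (h : ∀ᶠ z in B.nhdsAt x a, p z) :
    ∃ O ∈ @nhds _ α.quotientTop (α.totMap ⟨x, a⟩), ∃ N ∈ 𝓝 x, ∀ v ∈ N, ∀ b : A v,
      α.totMap ⟨v, b⟩ ∈ O → p ⟨v, b⟩ := by
  let := B.top
  let := α.quotientTop
  -- Continuity of the action at the unit of `x`: a point over `N'` equivalent to a point of `W`
  -- over `N'` is reached from it by an arrow near this unit.
  have h' : ∀ᶠ z in B.nhdsAt x (α.V (G.unit x) (G.s_unit x) (G.r_unit x) a), p z := by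
    rwa [α.V_self hp]
  obtain ⟨N, hN, W, hW, H⟩ := α.eventually_V _ _ a h'
  obtain ⟨N', hN', hN''⟩ := hG.eventually_unit hp x hN
  have hW' : W ∩ (fun z : Tot A => z.proj) ⁻¹' N' ∈ B.nhdsAt x a :=
    inter_mem hW (B.tendsto_proj x a hN')
  refine ⟨_, (α.isOpenQuotientMap_totMap hp hr).isOpenMap.image_mem_nhds hW', N', hN', ?_⟩
  rintro v hv b ⟨⟨w, c⟩, ⟨hw, hw'⟩, hbc⟩
  obtain ⟨γ, hs, hr', rfl⟩ := α.exists_V_eq hp hbc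
  exact H γ (hN'' γ (by rwa [hs]) (by rwa [hr'])) _ _ hs hr' c hw

/-- The equivariant section which corresponds to a section of the quotient bundle. -/
def liftSection (f : ∀ y : G.OrbitSpace, A (rep y)) (v : X) : A v :=
  (α.toRep v _ rfl).symm (f (G.orbitMap v))

theorem isEquivariant_liftSection (hp : G.IsPrincipal) (f : ∀ y : G.OrbitSpace, A (rep y)) :
    α.IsEquivariant (α.liftSection f) := by
  intro γ
  -- The orbits of `s γ` and `r γ` are only propositionally equal, so both are compared with a
  -- common variable `y`.
  have h : ∀ y (h1 : G.orbitMap (G.s γ) = y) (h2 : G.orbitMap (G.r γ) = y),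
      (α.toRep (G.r γ) y h2).symm (f y) = α.V γ rfl rfl ((α.toRep (G.s γ) y h1).symm (f y)) := by
    intro y h1 h2
    refine (α.toRep (G.r γ) y h2).injective (Eq.trans ?_ (α.toRep_V hp rfl rfl h1 h2 _).symm)
    exact (StarAlgEquiv.apply_symm_apply _ _).trans (StarAlgEquiv.apply_symm_apply _ _).symm
  have e : G.orbitMap (G.s γ) = G.orbitMap (G.r γ) := G.orbitMap_eq.2 ⟨γ, rfl, rfl⟩
  refine (h _ e rfl).trans ?_
  have : ∀ y (h1 : G.orbitMap (G.s γ) = y),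
      (α.toRep (G.s γ) y h1).symm (f y) = α.liftSection f (G.s γ) := by
    rintro _ rfl
    rfl
  rw [this]

variable [LocallyCompactSpace X] [T2Space X]

/-- Serves both addition and multiplication. Two points in one quotient fibre have to be lifted over
the same `v`, simultaneously close to the two given lifts over `x`. Openness of the orbit map
provides `v` near `x`, and by `eventually_of_totMap` every lift over such a `v` is automatically
close. -/
theorem continuous_quotient_op (hp : G.IsPrincipal) (hG : G.IsProper) (hr : IsOpenMap G.r)
    (op : ∀ {x : X}, A x → A x → A x)
    (hop : ∀ {x y : X} (e : A x ≃⋆ₐ[ℂ] A y) (a b : A x), e (op a b) = op (e a) (e b))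
    (hc : Continuous[fibredProductTopology A B.top, B.top] fun z : Tot₂ A =>
      (⟨z.proj, op z.snd.1 z.snd.2⟩ : Tot A)) :
    Continuous[fibredProductTopology _ α.quotientTop, α.quotientTop]
      fun z : Tot₂ (fun y : G.OrbitSpace => A (rep y)) =>
        (⟨z.proj, op z.snd.1 z.snd.2⟩ : Tot fun y : G.OrbitSpace => A (rep y)) := by
  let := B.top
  let := fibredProductTopology A B.top
  let := α.quotientTop
  let := fibredProductTopology (fun y : G.OrbitSpace => A (rep y)) α.quotientTop
  have hπ := α.isOpenQuotientMap_totMap hp hr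
  rw [continuous_iff_continuousAt]
  rintro ⟨y, a, b⟩ S hS
  obtain ⟨x, hx⟩ : ∃ x, G.orbitMap x = y := ⟨_, orbitMap_rep y⟩
  obtain ⟨a, rfl⟩ := (α.toRep x y hx).surjective a
  obtain ⟨b, rfl⟩ := (α.toRep x y hx).surjective b
  have h1 : ∀ᶠ z in B.nhdsAt x (op a b), α.totMap z ∈ S := by
    refine hπ.continuous.continuousAt ?_
    rw [α.totMap_mk hx, hop]
    exact hS
  have h2 := (hc.tendsto (⟨x, (a, b)⟩ : Tot₂ A)).eventually h1
  rw [nhds_induced, eventually_comap, nhds_prod_eq, eventually_prod_iff] at h2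
  obtain ⟨p, ha, q, hb, H⟩ := h2
  obtain ⟨O₁, hO₁, N₁, hN₁, H₁⟩ := α.eventually_of_totMap hp hG hr ha
  obtain ⟨O₂, hO₂, N₂, hN₂, H₂⟩ := α.eventually_of_totMap hp hG hr hb
  rw [α.totMap_mk hx] at hO₁ hO₂
  have hN := (TopologicalGroupoid.isOpenMap_orbitMap hr).image_mem_nhds (inter_mem hN₁ hN₂)
  rw [hx] at hN
  have hproj : Continuous fun z : Tot fun y : G.OrbitSpace => A (rep y) => z.proj := by
    rw [hπ.isQuotientMap.continuous_iff]
    exact G.isQuotientMap_orbitMap.continuous.comp B.continuous_proj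
  have hd : Continuous fun z : Tot₂ (fun y : G.OrbitSpace => A (rep y)) =>
      ((⟨z.proj, z.snd.1⟩, ⟨z.proj, z.snd.2⟩) :
        (Tot fun y : G.OrbitSpace => A (rep y)) × Tot fun y : G.OrbitSpace => A (rep y)) :=
    continuous_induced_dom
  rw [mem_map]
  filter_upwards [(continuous_fst.comp hd).continuousAt hO₁,
    (continuous_snd.comp hd).continuousAt hO₂,
    (hproj.comp (continuous_fst.comp hd)).continuousAt hN]
  rintro ⟨y', a', b'⟩ h₁ h₂ ⟨v, ⟨hv₁, hv₂⟩, hv⟩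
  change G.orbitMap v = y' at hv
  obtain ⟨a', rfl⟩ := (α.toRep v y' hv).surjective a'
  obtain ⟨b', rfl⟩ := (α.toRep v y' hv).surjective b'
  have h3 := H (H₁ v hv₁ a' (by rw [α.totMap_mk hv]; exact h₁))
    (H₂ v hv₂ b' (by rw [α.totMap_mk hv]; exact h₂)) ⟨v, (a', b')⟩ rfl
  simp only [α.totMap_mk hv, hop] at h3
  exact h3

/-- The quotient of the bundle by the action: a bundle over the orbit space. -/
def quotientBundle (hp : G.IsPrincipal) (hG : G.IsProper) (hr : IsOpenMap G.r) :
    USCBundle fun y : G.OrbitSpace => A (rep y) where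
  top := α.quotientTop
  continuous_proj := by
    let := B.top
    let := α.quotientTop
    rw [(α.isOpenQuotientMap_totMap hp hr).isQuotientMap.continuous_iff]
    exact G.isQuotientMap_orbitMap.continuous.comp B.continuous_proj
  isOpenMap_proj := by
    let := B.top
    let := α.quotientTop
    rw [(α.isOpenQuotientMap_totMap hp hr).isOpenMap_iff]
    exact (TopologicalGroupoid.isOpenMap_orbitMap hr).comp B.isOpenMap_proj
  upperSemicontinuous_norm := by
    let := B.top
    let := α.quotientTop
    rw [upperSemicontinuous_iff_isOpen_preimage]
    intro c
    rw [← (α.isOpenQuotientMap_totMap hp hr).isQuotientMap.isOpen_preimage]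
    convert upperSemicontinuous_iff_isOpen_preimage.1 B.upperSemicontinuous_norm c using 1
    ext z
    simp only [mem_preimage, mem_Iio]
    rw [show ‖(α.totMap z).snd‖ = ‖z.snd‖ from α.norm_toRep _ _]
  continuous_add := α.continuous_quotient_op hp hG hr (fun a b => a + b)
    (fun e a b => map_add e a b) B.continuous_add
  continuous_smul k := by
    let := B.top
    let := α.quotientTop
    have hπ := α.isOpenQuotientMap_totMap hp hr
    rw [hπ.isQuotientMap.continuous_iff]
    convert hπ.continuous.comp (B.continuous_smul k) using 1
    ext1 z
    exact congrArg (fun c => (⟨_, c⟩ : Tot fun y : G.OrbitSpace => A (rep y)))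
      (map_smul (α.toRep z.proj _ rfl) k z.snd).symm
  tendsto_zero y F h1 h2 := by
    let := B.top
    let := α.quotientTop
    have hπ := α.isOpenQuotientMap_totMap hp hr
    obtain ⟨x, rfl⟩ := G.isQuotientMap_orbitMap.surjective y
    intro S hS
    have h3 : ∀ᶠ z in B.nhdsAt x (0 : A x), α.totMap z ∈ S := by
      refine hπ.continuous.continuousAt ?_
      rw [α.totMap_mk rfl, map_zero]
      exact hS
    obtain ⟨δ, hδ, h4⟩ := USCBundle.eventually_zero h3
    have h5 := h2 ((TopologicalGroupoid.isOpenMap_orbitMap hr).image_mem_nhds h4)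
    rw [mem_map] at h5 ⊢
    filter_upwards [h1.eventually (gt_mem_nhds hδ), h5]
    rintro ⟨y, c⟩ hc ⟨v, hv, hvy⟩
    have := hv ((α.toRep v y hvy).symm c) (by rwa [α.norm_toRep_symm])
    rwa [α.totMap_mk_symm] at this
  continuous_mul := α.continuous_quotient_op hp hG hr (fun a b => a * b)
    (fun e a b => map_mul e a b) B.continuous_mul
  continuous_star := by
    let := B.top
    let := α.quotientTop
    have hπ := α.isOpenQuotientMap_totMap hp hr
    rw [hπ.isQuotientMap.continuous_iff]
    convert hπ.continuous.comp B.continuous_star using 1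
    ext1 z
    exact congrArg (fun c => (⟨_, c⟩ : Tot fun y : G.OrbitSpace => A (rep y)))
      (map_star (α.toRep z.proj _ rfl) z.snd).symm

theorem isContinuousSection_liftSection (hp : G.IsPrincipal) (hG : G.IsProper)
    (hr : IsOpenMap G.r) {f : ∀ y : G.OrbitSpace, A (rep y)}
    (hf : (α.quotientBundle hp hG hr).IsContinuousSection f) :
    B.IsContinuousSection (α.liftSection f) := by
  rw [USCBundle.isContinuousSection_iff]
  intro x S hS
  let := α.quotientTop
  obtain ⟨O, hO, N, hN, H⟩ := α.eventually_of_totMap hp hG hr (p := (· ∈ S)) hS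
  have e : ∀ v, α.totMap ⟨v, α.liftSection f v⟩ = ⟨G.orbitMap v, f (G.orbitMap v)⟩ := fun v =>
    α.totMap_mk_symm rfl _
  rw [e] at hO
  have hc : Continuous fun y => (⟨y, f y⟩ : Tot fun y : G.OrbitSpace => A (rep y)) := hf
  rw [mem_map]
  filter_upwards [hN, (hc.comp G.isQuotientMap_orbitMap.continuous).continuousAt hO] with v hv hv'
  exact H v hv _ (by rw [e]; exact hv')

theorem exists_ind_near [SecondCountableTopology X] (hp : G.IsPrincipal) (hG : G.IsProper)
    (hr : IsOpenMap G.r) (u : X) (a : A u) {ε : ℝ} (hε : 0 < ε) :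
    ∃ f : α.Ind, ‖(f : lp A ∞) u - a‖ ≤ ε := by
  have := hG.t2Space hr
  have := TopologicalGroupoid.locallyCompactSpace_orbitSpace hr
  obtain ⟨f, hf, hfa, K, hK, hfK⟩ := USCBundle.exists_section_near
    (B := α.quotientBundle hp hG hr) (G.orbitMap u) (α.toRep u _ rfl a) hε
  have hn : ∀ v, ‖α.liftSection f v‖ = ‖f (G.orbitMap v)‖ := fun v => α.norm_toRep_symm _ _
  have h1 := α.isContinuousSection_liftSection hp hG hr hf
  have h2 := α.isEquivariant_liftSection hp f
  let := α.quotientTop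
  -- The norm of a section is only upper semicontinuous, which still bounds it above on a compact
  -- set.
  obtain ⟨C, hC⟩ : BddAbove ((fun y => ‖f y‖) '' K) := by
    refine UpperSemicontinuousOn.bddAbove_of_isCompact hK ?_
    have := (α.quotientBundle hp hG hr).upperSemicontinuous_norm.comp hf
    exact this.upperSemicontinuousOn K
  have hb : Memℓp (α.liftSection f) ∞ := by
    refine memℓp_infty ⟨max C 0, ?_⟩
    rintro _ ⟨v, rfl⟩
    simp only [hn]
    by_cases hv : G.orbitMap v ∈ K
    · exact (hC ⟨_, hv, rfl⟩).trans (le_max_left _ _)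
    · simp [hfK _ hv]
  refine ⟨⟨⟨α.liftSection f, hb⟩, h1, h2, .of_subset h2 h1 fun η hη => ⟨K, hK, ?_⟩⟩, ?_⟩
  · rintro _ ⟨v, hv, rfl⟩
    by_contra hvK
    have hv' : η ≤ ‖α.liftSection f v‖ := hv
    rw [hn, hfK _ hvK, norm_zero] at hv'
    linarith
  · change ‖(α.toRep u _ rfl).symm (f (G.orbitMap u)) - a‖ ≤ ε
    have e : (α.toRep u _ rfl).symm (f (G.orbitMap u)) - a =
        (α.toRep u _ rfl).symm (f (G.orbitMap u) - α.toRep u _ rfl a) := by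
      rw [map_sub, StarAlgEquiv.symm_apply_apply]
    rw [e, α.norm_toRep_symm]
    exact hfa

end GroupoidAction

/-! ### Cut-off functions and the action of functions on the orbit space -/

/-- The function in `C₀(T)` given by a real function of compact support. -/
def ContinuousMap.toC₀ {T : Type*} [TopologicalSpace T] (f : C(T, ℝ)) (hf : HasCompactSupport f) :
    C₀(T, ℂ) where
  toFun t := (f t : ℂ)
  continuous_toFun := Complex.continuous_ofReal.comp f.continuous
  zero_at_infty' := (hf.comp_left (g := fun x : ℝ => (x : ℂ)) Complex.ofReal_zero).is_zero_at_infty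

theorem ZeroAtInftyContinuousMap.exists_cutoff {T : Type*} [TopologicalSpace T] [T2Space T]
    [LocallyCompactSpace T] {K C : Set T} (hK : IsCompact K) (hC : IsClosed C)
    (h : Disjoint K C) :
    ∃ φ : C₀(T, ℂ), (∀ t ∈ K, φ t = 1) ∧ (∀ t ∈ C, φ t = 0) ∧ ∀ t, ‖φ t - 1‖ ≤ 1 := by
  obtain ⟨f, h1, h0, hc, hf⟩ := exists_continuous_one_zero_of_isCompact hK hC h
  refine ⟨f.toC₀ hc, fun t ht => ?_, fun t ht => ?_, fun t => ?_⟩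
  · change ((f t : ℝ) : ℂ) = 1
    rw [h1 ht]; simp
  · change ((f t : ℝ) : ℂ) = 0
    rw [h0 ht]; simp
  · change ‖((f t : ℝ) : ℂ) - 1‖ ≤ 1
    rw [← Complex.ofReal_one, ← Complex.ofReal_sub, Complex.norm_real, Real.norm_eq_abs, abs_le]
    have := hf t
    constructor <;> linarith [this.1, this.2]

theorem ZeroAtInftyContinuousMap.norm_apply_le {T : Type*} [TopologicalSpace T] (φ : C₀(T, ℂ))
    (t : T) : ‖φ t‖ ≤ ‖φ‖ := by
  rw [← ZeroAtInftyContinuousMap.norm_toBCF_eq_norm]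
  exact φ.toBCF.norm_coe_le_norm t

namespace GroupoidAction

variable {E X : Type*} [TopologicalSpace E] [TopologicalSpace X] {G : TopologicalGroupoid E X}
  {A : X → Type*} [∀ x, NonUnitalCStarAlgebra (A x)] {B : USCBundle A} {α : GroupoidAction G B}

theorem ind_ext {f g : α.Ind} (h : ∀ v, (f : lp A ∞) v = (g : lp A ∞) v) : f = g :=
  Subtype.ext (lp.ext (funext h))

theorem norm_ind_le {f : α.Ind} {C : ℝ} (hC : 0 ≤ C) (h : ∀ v, ‖(f : lp A ∞) v‖ ≤ C) : ‖f‖ ≤ C :=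
  lp.norm_le_of_forall_le (f := (f : lp A ∞)) hC h

theorem norm_ind_apply_le (f : α.Ind) (v : X) : ‖(f : lp A ∞) v‖ ≤ ‖f‖ :=
  lp.norm_apply_le_norm ENNReal.top_ne_zero (f : lp A ∞) v

theorem norm_ind_eq_of_orbitMap_eq (f : α.Ind) {v w : X} (h : G.orbitMap v = G.orbitMap w) :
    ‖(f : lp A ∞) v‖ = ‖(f : lp A ∞) w‖ := by
  obtain ⟨γ, rfl, rfl⟩ := G.orbitMap_eq.1 h
  exact (f.2.2.1.norm_eq γ).symm

/-- The pointwise product of `φ ∈ C₀(E \ E⁽⁰⁾)` and `f ∈ Ind(A, α)`. -/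
def c₀Smul (φ : C₀(G.OrbitSpace, ℂ)) (f : α.Ind) : α.Ind := by
  have hφ : ∀ v, ‖φ (G.orbitMap v) • (f : lp A ∞) v‖ ≤ ‖φ‖ * ‖(f : lp A ∞) v‖ := fun v => by
    rw [norm_smul]
    exact mul_le_mul_of_nonneg_right (φ.norm_apply_le _) (norm_nonneg _)
  have h1 : B.IsContinuousSection fun v => φ (G.orbitMap v) • (f : lp A ∞) v :=
    USCBundle.IsContinuousSection.fun_smul B f.2.1
      (φ.continuous.comp G.isQuotientMap_orbitMap.continuous)
  have h2 : α.IsEquivariant fun v => φ (G.orbitMap v) • (f : lp A ∞) v := fun γ => by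
    have e : G.orbitMap (G.r γ) = G.orbitMap (G.s γ) :=
      (G.orbitMap_eq.2 ⟨γ, rfl, rfl⟩ : G.orbitMap (G.s γ) = _).symm
    simp only [e, map_smul, f.2.2.1 γ]
  refine ⟨⟨fun v => φ (G.orbitMap v) • (f : lp A ∞) v, memℓp_infty ⟨‖φ‖ * ‖f‖, ?_⟩⟩, h1, h2,
    .of_subset h2 h1 fun ε hε => ⟨_, f.2.2.2 (ε / (‖φ‖ + 1)) (by positivity), ?_⟩⟩
  · rintro _ ⟨v, rfl⟩
    exact (hφ v).trans (mul_le_mul_of_nonneg_left (norm_ind_apply_le f v) (norm_nonneg _))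
  · refine image_mono fun v hv => ?_
    have hv' : ε ≤ ‖φ (G.orbitMap v) • (f : lp A ∞) v‖ := hv
    have := hφ v
    simp only [mem_ofPred_eq]
    rw [div_le_iff₀ (by positivity)]
    nlinarith [norm_nonneg ((f : lp A ∞) v)]

/-- `f ↦ φ f` as a bounded operator on `Ind(A, α)`. -/
def c₀SmulL (φ : C₀(G.OrbitSpace, ℂ)) : α.Ind →L[ℂ] α.Ind :=
  LinearMap.mkContinuous
    { toFun := c₀Smul φ
      map_add' := fun f g => ind_ext fun v => smul_add (φ (G.orbitMap v)) _ _
      map_smul' := fun k f => ind_ext fun v => smul_comm (φ (G.orbitMap v)) k _ }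
    ‖φ‖ fun f => norm_ind_le (by positivity) fun v => by
      change ‖φ (G.orbitMap v) • (f : lp A ∞) v‖ ≤ _
      rw [norm_smul]
      exact mul_le_mul (φ.norm_apply_le _) (norm_ind_apply_le f v) (norm_nonneg _) (norm_nonneg _)

theorem c₀SmulL_apply (φ : C₀(G.OrbitSpace, ℂ)) (f : α.Ind) (v : X) :
    (c₀SmulL φ f : lp A ∞) v = φ (G.orbitMap v) • (f : lp A ∞) v := rfl

/-- The multiplier `f ↦ φ f` of `Ind(A, α)`. -/
def c₀Multiplier (φ : C₀(G.OrbitSpace, ℂ)) : 𝓜(ℂ, α.Ind) where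
  fst := c₀SmulL φ
  snd := c₀SmulL φ
  central f g := ind_ext fun v => by
    change (φ (G.orbitMap v) • (f : lp A ∞) v) * (g : lp A ∞) v =
      (f : lp A ∞) v * (φ (G.orbitMap v) • (g : lp A ∞) v)
    rw [smul_mul_assoc, mul_smul_comm]

theorem multiplier_ext {m n : 𝓜(ℂ, α.Ind)}
    (h1 : ∀ f v, (m.fst f : lp A ∞) v = (n.fst f : lp A ∞) v)
    (h2 : ∀ f v, (m.snd f : lp A ∞) v = (n.snd f : lp A ∞) v) : m = n :=
  DoubleCentralizer.ext _ _ _ _ (Prod.ext (ContinuousLinearMap.ext fun f => ind_ext (h1 f))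
    (ContinuousLinearMap.ext fun f => ind_ext (h2 f)))

variable (α) in
/-- The `*`-homomorphism `Q : C₀(E \ E⁽⁰⁾) → M(Ind(A, α))`. -/
def c₀Hom : C₀(G.OrbitSpace, ℂ) →⋆ₙₐ[ℂ] 𝓜(ℂ, α.Ind) where
  toFun := c₀Multiplier
  map_smul' k φ := multiplier_ext (fun f v => smul_assoc k (φ (G.orbitMap v)) ((f : lp A ∞) v))
    fun f v => smul_assoc k (φ (G.orbitMap v)) ((f : lp A ∞) v)
  map_zero' := multiplier_ext (fun f v => zero_smul ℂ ((f : lp A ∞) v))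
    fun f v => zero_smul ℂ ((f : lp A ∞) v)
  map_add' φ ψ := multiplier_ext
    (fun f v => add_smul (φ (G.orbitMap v)) (ψ (G.orbitMap v)) ((f : lp A ∞) v))
    fun f v => add_smul (φ (G.orbitMap v)) (ψ (G.orbitMap v)) ((f : lp A ∞) v)
  map_mul' φ ψ := multiplier_ext
    (fun f v => mul_smul (φ (G.orbitMap v)) (ψ (G.orbitMap v)) ((f : lp A ∞) v))
    fun f v => by
      refine Eq.trans ?_ (mul_smul (ψ (G.orbitMap v)) (φ (G.orbitMap v)) ((f : lp A ∞) v))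
      rw [mul_comm (ψ _)]
      rfl
  map_star' φ := by
    have h : ∀ (f : α.Ind) v, star (φ (G.orbitMap v)) • (f : lp A ∞) v =
        star (φ (G.orbitMap v) • (star f : lp A ∞) v) := fun f v => by
      rw [star_smul]
      simp
    exact multiplier_ext h h

theorem c₀Hom_mem_center (φ : C₀(G.OrbitSpace, ℂ)) : c₀Hom α φ ∈ Set.center 𝓜(ℂ, α.Ind) := by
  rw [Semigroup.mem_center_iff]
  intro m
  -- The difference of the two sides at `f` is annihilated by every left factor `g`; its own adjoint
  -- as `g` makes it zero by the C⋆-identity.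
  have key : m.fst.comp (c₀SmulL φ) = (c₀SmulL φ).comp m.fst := by
    refine ContinuousLinearMap.ext fun f => ?_
    have h : ∀ g : α.Ind, g * (m.fst (c₀SmulL φ f) - c₀SmulL φ (m.fst f)) = 0 := fun g => by
      have hc : ∀ a b : α.Ind, a * c₀SmulL φ b = c₀SmulL φ a * b := fun a b =>
        ((c₀Multiplier φ).central a b).symm
      have hc' : ∀ a b : α.Ind, a * c₀SmulL φ b = c₀SmulL φ (a * b) := fun a b =>
        ind_ext fun v => mul_smul_comm _ _ _
      rw [mul_sub, ← m.central, hc', hc', m.central, sub_self]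
    have := h (star (m.fst (c₀SmulL φ f) - c₀SmulL φ (m.fst f)))
    rwa [CStarRing.star_mul_self_eq_zero_iff, sub_eq_zero] at this
  -- The norm of a double centralizer is that of its first component, so commutation of the first
  -- components is enough.
  rw [← sub_eq_zero, ← norm_eq_zero, ← DoubleCentralizer.norm_fst, norm_eq_zero]
  change m.fst.comp (c₀SmulL φ) - (c₀SmulL φ).comp m.fst = 0
  rw [key, sub_self]

theorem norm_c₀Smul_sub_le {φ : C₀(G.OrbitSpace, ℂ)} (hφ : ∀ y, ‖φ y - 1‖ ≤ 1) {f : α.Ind} {ε : ℝ}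
    (hε : 0 ≤ ε) (h : ∀ v, ε ≤ ‖(f : lp A ∞) v‖ → φ (G.orbitMap v) = 1) :
    ‖c₀SmulL φ f - f‖ ≤ ε := by
  refine norm_ind_le hε fun v => ?_
  have e : ((c₀SmulL φ f - f : α.Ind) : lp A ∞) v = (φ (G.orbitMap v) - 1) • (f : lp A ∞) v := by
    rw [sub_smul, one_smul]
    rfl
  rw [e]
  rcases le_or_gt ε ‖(f : lp A ∞) v‖ with hv | hv
  · simpa [h v hv] using hε
  · rw [norm_smul]
    nlinarith [hφ (G.orbitMap v), norm_nonneg ((f : lp A ∞) v)]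

/-! ### Separability and nondegeneracy -/

/-- Cutting down by a compactly supported function maps `Ind(A, α)` to the section algebra. -/
theorem exists_cutSection [T2Space X] (χ : C(X, ℝ)) (hχ : HasCompactSupport χ)
    (hχ1 : ∀ x, χ x ∈ Icc (0 : ℝ) 1) (f : α.Ind) :
    ∃ g ∈ B.sections₀, ∀ v, g v = ((χ v : ℝ) : ℂ) • (f : lp A ∞) v := by
  have h1 : B.IsContinuousSection fun v => ((χ v : ℝ) : ℂ) • (f : lp A ∞) v :=
    USCBundle.IsContinuousSection.fun_smul B f.2.1 (Complex.continuous_ofReal.comp χ.continuous)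
  refine ⟨⟨fun v => ((χ v : ℝ) : ℂ) • (f : lp A ∞) v, memℓp_infty ⟨‖f‖, ?_⟩⟩, ⟨h1, ?_⟩,
    fun v => rfl⟩
  · rintro _ ⟨v, rfl⟩
    simp only [norm_smul, Complex.norm_real, Real.norm_of_nonneg (hχ1 v).1]
    have := norm_ind_apply_le f v
    nlinarith [(hχ1 v).2, (hχ1 v).1, norm_nonneg ((f : lp A ∞) v)]
  · intro ε hε
    refine hχ.isCompact.of_isClosed_subset (B.isClosed_of_section h1 ε) fun v hv => ?_
    by_contra hv'
    have hv : ε ≤ ‖((χ v : ℝ) : ℂ) • (f : lp A ∞) v‖ := hv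
    rw [image_eq_zero_of_notMem_tsupport hv'] at hv
    simp at hv
    linarith

/-- Multiplication by a cut-off `χ` with `χ = 1` on `K` embeds these elements isometrically in the
section algebra: norms are constant on orbits, and each orbit where the element may be nonzero meets
`K`. -/
theorem isSeparable_supported [T2Space X] [LocallyCompactSpace X]
    (hsep : TopologicalSpace.IsSeparable B.sections₀) {K : Set X} (hK : IsCompact K) :
    TopologicalSpace.IsSeparable
      {f : α.Ind | ∀ v, G.orbitMap v ∉ G.orbitMap '' K → (f : lp A ∞) v = 0} := by
  obtain ⟨χ, hχ1, -, hχ, hχ01⟩ := exists_continuous_one_zero_of_isCompact hK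
    (isClosed_empty (X := X)) (disjoint_empty _)
  choose j hj hj' using exists_cutSection (α := α) χ hχ hχ01
  set S := {f : α.Ind | ∀ v, G.orbitMap v ∉ G.orbitMap '' K → (f : lp A ∞) v = 0}
  have hd : ∀ f ∈ S, ∀ g ∈ S, dist (j f) (j g) = dist f g := by
    intro f hf g hg
    rw [dist_eq_norm, dist_eq_norm]
    have e : ∀ v, (j f - j g) v = ((χ v : ℝ) : ℂ) • ((f - g : α.Ind) : lp A ∞) v := fun v => by
      change j f v - j g v = ((χ v : ℝ) : ℂ) • ((f : lp A ∞) v - (g : lp A ∞) v)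
      rw [hj', hj', smul_sub]
    refine le_antisymm (lp.norm_le_of_forall_le (norm_nonneg _) fun v => ?_)
      (norm_ind_le (norm_nonneg _) fun v => ?_)
    · rw [e, norm_smul, Complex.norm_real, Real.norm_of_nonneg (hχ01 v).1]
      have := norm_ind_apply_le (f - g) v
      nlinarith [(hχ01 v).2, (hχ01 v).1, norm_nonneg (((f - g : α.Ind) : lp A ∞) v)]
    · by_cases hv : G.orbitMap v ∈ G.orbitMap '' K
      · obtain ⟨w, hw, hwv⟩ := hv
        rw [← norm_ind_eq_of_orbitMap_eq _ hwv]
        have := lp.norm_apply_le_norm ENNReal.top_ne_zero (j f - j g) w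
        rw [e, hχ1 hw] at this
        simpa using this
      · have : ((f - g : α.Ind) : lp A ∞) v = (f : lp A ∞) v - (g : lp A ∞) v := rfl
        rw [this, hf v hv, hg v hv]
        simp
  have : TopologicalSpace.SeparableSpace B.sections₀ := hsep.separableSpace
  -- Second countability, unlike separability, pulls back along any inducing map.
  have : SecondCountableTopology B.sections₀ := UniformSpace.secondCountable_of_separable _
  have hi : Isometry fun f : S => (⟨j f, hj f⟩ : B.sections₀) :=
    Isometry.of_dist_eq fun f g => hd f f.2 g g.2
  have : SecondCountableTopology S := hi.isUniformInducing.isInducing.secondCountableTopology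
  exact TopologicalSpace.IsSeparable.of_subtype S

section Cutoff

variable [LocallyCompactSpace G.OrbitSpace] [T2Space G.OrbitSpace]

/-- The orbits with `‖f‖ ≥ ε` form a compact set. A cut-off equal to `1` there changes `f` only
where its norm is below `ε`. -/
theorem exists_c₀Smul_near (f : α.Ind) {ε : ℝ} (hε : 0 < ε) {U : Set G.OrbitSpace} (hU : IsOpen U)
    (h : ∀ v, ε ≤ ‖(f : lp A ∞) v‖ → G.orbitMap v ∈ U) :
    ∃ φ : C₀(G.OrbitSpace, ℂ), (∀ y ∉ U, φ y = 0) ∧ ‖c₀SmulL φ f - f‖ ≤ ε := by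
  obtain ⟨φ, h1, h0, hφ⟩ := ZeroAtInftyContinuousMap.exists_cutoff (f.2.2.2 ε hε)
    hU.isClosed_compl (by
      rw [disjoint_compl_right_iff_subset]
      rintro _ ⟨v, hv, rfl⟩
      exact h v hv)
  exact ⟨φ, h0, norm_c₀Smul_sub_le hφ hε.le fun v hv => h1 _ ⟨v, hv, rfl⟩⟩

theorem c₀Hom_nondegenerate :
    (Submodule.span ℂ {x : α.Ind | ∃ (φ : C₀(G.OrbitSpace, ℂ)) (b : α.Ind),
      x = (c₀Hom α φ).fst b}).topologicalClosure = ⊤ := by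
  refine eq_top_iff.2 fun f _ => ?_
  refine Metric.mem_closure_iff.2 fun ε hε => ?_
  obtain ⟨φ, -, hφ⟩ := exists_c₀Smul_near f (half_pos hε) isOpen_univ fun v _ => mem_univ _
  refine ⟨c₀SmulL φ f, Submodule.subset_span ⟨φ, f, rfl⟩, ?_⟩
  rw [dist_comm, dist_eq_norm]
  linarith

theorem separableSpace_ind [T2Space X] [LocallyCompactSpace X] [SecondCountableTopology X]
    (hr : IsOpenMap G.r) (hsep : TopologicalSpace.IsSeparable B.sections₀) :
    TopologicalSpace.SeparableSpace α.Ind := by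
  let K := CompactExhaustion.choice X
  rw [← TopologicalSpace.isSeparable_univ_iff]
  refine (TopologicalSpace.IsSeparable.iUnion fun n =>
    isSeparable_supported (α := α) hsep (K.isCompact n)).closure.mono fun f _ => ?_
  refine Metric.mem_closure_iff.2 fun ε hε => ?_
  -- The images of the interiors of the exhaustion are an increasing open cover of the orbit space,
  -- so one of them contains all orbits where `f` is not small.
  obtain ⟨n, hn⟩ := (f.2.2.2 (ε / 2) (half_pos hε)).elim_directed_cover
    (fun n => G.orbitMap '' interior (K n))
    (fun n => TopologicalGroupoid.isOpenMap_orbitMap hr _ isOpen_interior)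
    (fun y _ => by
      obtain ⟨v, rfl⟩ := G.isQuotientMap_orbitMap.surjective y
      obtain ⟨n, hn⟩ := mem_iUnion.1 (K.iUnion_eq ▸ mem_univ v)
      exact mem_iUnion.2 ⟨n + 1, v, K.subset_interior_succ n hn, rfl⟩)
    (directed_of_isDirected_le fun m n h => image_mono (interior_mono (K.subset h)))
  obtain ⟨φ, hφ0, hφ⟩ := exists_c₀Smul_near f (half_pos hε)
    (TopologicalGroupoid.isOpenMap_orbitMap hr _ (isOpen_interior (s := K n)))
    fun v hv => hn ⟨v, hv, rfl⟩
  refine ⟨c₀SmulL φ f, mem_iUnion.2 ⟨n, fun v hv => ?_⟩, ?_⟩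
  · rw [c₀SmulL_apply, hφ0 _ fun h => hv (image_mono interior_subset h), zero_smul]
  · rw [dist_comm, dist_eq_norm]
    linarith

end Cutoff

variable (α) in
/-- `Ind(A, α)` as a `C₀(E \ E⁽⁰⁾)`-algebra. -/
def indC0Algebra [T2Space X] [LocallyCompactSpace X] [SecondCountableTopology X]
    (hG : G.IsProper) (hr : IsOpenMap G.r) (hsep : TopologicalSpace.IsSeparable B.sections₀) :
    C0Algebra G.OrbitSpace α.Ind where
  t2Space := hG.t2Space hr
  locallyCompactSpace := TopologicalGroupoid.locallyCompactSpace_orbitSpace hr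
  secondCountableTopology := TopologicalGroupoid.secondCountableTopology_orbitSpace hr
  separableSpace := by
    have := hG.t2Space hr
    have := TopologicalGroupoid.locallyCompactSpace_orbitSpace hr
    exact separableSpace_ind hr hsep
  toHom := c₀Hom α
  mem_center := c₀Hom_mem_center
  nondegenerate := by
    have := hG.t2Space hr
    have := TopologicalGroupoid.locallyCompactSpace_orbitSpace hr
    exact c₀Hom_nondegenerate

end GroupoidAction

/-! ### Fibres as images of homomorphisms -/

namespace C0Algebra

variable {T : Type*} [TopologicalSpace T] {B : Type*} [NonUnitalCStarAlgebra B]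
  (Θ : C0Algebra T B)

theorem toFibre_surjective (t : T) : Function.Surjective (Θ.toFibre t) :=
  (Θ.fibreIdeal t).mkQ_surjective

theorem toFibre_sub (t : T) (a b : B) : Θ.toFibre t (a - b) = Θ.toFibre t a - Θ.toFibre t b := rfl

theorem norm_toFibre_le (t : T) (b : B) : ‖Θ.toFibre t b‖ ≤ ‖b‖ :=
  Submodule.Quotient.norm_mk_le (Θ.fibreIdeal t) b

theorem exists_norm_lt (t : T) (b : B) {ε : ℝ} (hε : 0 < ε) :
    ∃ c, Θ.toFibre t c = Θ.toFibre t b ∧ ‖c‖ < ‖Θ.toFibre t b‖ + ε :=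
  Submodule.Quotient.norm_mk_lt (S := Θ.fibreIdeal t) (Θ.toFibre t b) hε

theorem toFibre_eq_iff (t : T) (a b : B) :
    Θ.toFibre t a = Θ.toFibre t b ↔ a - b ∈ Θ.fibreIdeal t :=
  Submodule.Quotient.eq (Θ.fibreIdeal t)

/-- A surjective `*`-homomorphism which induces an isometric map on a fibre identifies the fibre
with its codomain. -/
theorem exists_fibre_equiv (t : T) {D : Type*} [NonUnitalCStarAlgebra D] (ev : B →⋆ₙₐ[ℂ] D)
    (hs : Function.Surjective ev) (hn : ∀ b, ‖Θ.toFibre t b‖ = ‖ev b‖) :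
    ∃ e : Θ.Fibre t ≃⋆ₐ[ℂ] D, (∀ x, ‖e x‖ = ‖x‖) ∧ ∀ b, e (Θ.toFibre t b) = ev b := by
  have key : ∀ a b, Θ.toFibre t a = Θ.toFibre t b ↔ ev a = ev b := fun a b => by
    rw [← sub_eq_zero, ← toFibre_sub, ← norm_eq_zero, hn, norm_eq_zero, map_sub, sub_eq_zero]
  choose l hl using Θ.toFibre_surjective t
  choose m hm using hs
  have hl' : ∀ b, ev (l (Θ.toFibre t b)) = ev b := fun b => (key _ _).1 (hl _)
  refine ⟨
    { toFun := fun x => ev (l x)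
      invFun := fun d => Θ.toFibre t (m d)
      left_inv := fun x => by rw [← hl x, key, hm, hl]
      right_inv := fun d => (hl' _).trans (hm d)
      map_mul' := fun x y => by
        rw [← hl x, ← hl y, ← toFibre_mul, hl', hl', hl', map_mul]
      map_add' := fun x y => by
        rw [← hl x, ← hl y]
        change ev (l (Θ.toFibre t (l x + l y))) = _
        rw [hl', hl', hl', map_add]
      map_star' := fun x => by
        rw [← hl x, ← toFibre_star, hl', hl', map_star]
      map_smul' := fun k x => by
        rw [← hl x]
        change ev (l (Θ.toFibre t (k • l x))) = _
        rw [hl', hl', map_smul] }, fun x => ?_, fun b => hl' b⟩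
  obtain ⟨b, rfl⟩ := Θ.toFibre_surjective t x
  rw [hn, ← hl' b]
  rfl

end C0Algebra

/-! ### Evaluation at a unit and restriction to an orbit -/

namespace GroupoidAction

variable {E X : Type*} [TopologicalSpace E] [TopologicalSpace X] {G : TopologicalGroupoid E X}
  {A : X → Type*} [∀ x, NonUnitalCStarAlgebra (A x)] {B : USCBundle A} {α : GroupoidAction G B}

variable (α) in
/-- The evaluation `f ↦ f u`. -/
def evalHom (u : X) : α.Ind →⋆ₙₐ[ℂ] A u where
  toFun f := (f : lp A ∞) u
  map_smul' _ _ := rfl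
  map_zero' := rfl
  map_add' _ _ := rfl
  map_mul' _ _ := rfl
  map_star' _ := rfl

/-- The threshold `‖f u‖ + ε` exceeds the norm of `f` along `E · u`, so the complement of that orbit
is an admissible open set for the cut-off. -/
theorem exists_c₀Smul_sub_near [LocallyCompactSpace G.OrbitSpace] [T2Space G.OrbitSpace] (u : X)
    (f : α.Ind) {ε : ℝ} (hε : 0 < ε) : ∃ φ : C₀(G.OrbitSpace, ℂ), φ (G.orbitMap u) = 0 ∧
      ‖c₀SmulL φ f - f‖ ≤ ‖(f : lp A ∞) u‖ + ε := by
  obtain ⟨φ, hφ, h⟩ := exists_c₀Smul_near f (ε := ‖(f : lp A ∞) u‖ + ε) (by positivity)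
    (isOpen_compl_singleton (x := G.orbitMap u)) fun v hv h => by
      rw [norm_ind_eq_of_orbitMap_eq f h] at hv
      linarith
  exact ⟨φ, hφ _ (by simp), h⟩

variable (α) in
/-- The restriction of an element of the induced algebra to an orbit. -/
def restrictOrbit (u : X) (f : α.Ind) : (α.restrict (G.orbit u)).Ind := by
  let g : ∀ v : G.orbit u, A v := fun v => (f : lp A ∞) v
  have h1 : (B.restrict (G.orbit u)).IsContinuousSection g := by
    let := B.top
    let := (B.restrict (G.orbit u)).top
    have : Continuous fun v => (⟨v, (f : lp A ∞) v⟩ : Tot A) := f.2.1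
    exact continuous_induced_rng.2 (this.comp continuous_subtype_val)
  have h2 : (α.restrict (G.orbit u)).IsEquivariant g := fun γ => f.2.2.1 γ.1
  -- The restricted groupoid is transitive: its orbit space is one point and vanishing at infinity
  -- is automatic.
  refine ⟨⟨g, memℓp_infty ⟨‖f‖, ?_⟩⟩, h1, h2, fun ε hε => Set.Subsingleton.isCompact ?_⟩
  · rintro _ ⟨v, rfl⟩
    exact norm_ind_apply_le f v
  · rintro _ ⟨v, hv, rfl⟩ _ ⟨w, hw, rfl⟩
    obtain ⟨v, γ, hγ, rfl⟩ := v
    obtain ⟨w, η, hη, rfl⟩ := w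
    refine (G.restrict (G.orbit u)).orbitMap_eq.2 ⟨⟨G.mul η (G.inv γ)
      (hη.trans (hγ.symm.trans (G.r_inv γ).symm)), ?_, ?_⟩, Subtype.ext ?_, Subtype.ext ?_⟩
    · rw [G.r_mul]; exact ⟨η, hη, rfl⟩
    · rw [G.s_mul, G.s_inv]; exact ⟨γ, hγ, rfl⟩
    · exact (G.s_mul _ _ _).trans (G.s_inv _)
    · exact G.r_mul _ _ _

variable (α) in
/-- The restriction map `f ↦ f|_{E · u}` as a `*`-homomorphism. -/
def restrictOrbitHom (u : X) : α.Ind →⋆ₙₐ[ℂ] (α.restrict (G.orbit u)).Ind where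
  toFun := α.restrictOrbit u
  map_smul' _ _ := rfl
  map_zero' := rfl
  map_add' _ _ := rfl
  map_mul' _ _ := rfl
  map_star' _ := rfl

theorem mem_orbit_self (u : X) : u ∈ G.orbit u := ⟨G.unit u, G.s_unit u, G.r_unit u⟩

theorem orbitMap_restrict_orbit (u : X) (v : G.orbit u) :
    (G.restrict (G.orbit u)).orbitMap ⟨u, mem_orbit_self u⟩ =
      (G.restrict (G.orbit u)).orbitMap v := by
  obtain ⟨v, γ, hγ, rfl⟩ := v
  refine (G.restrict (G.orbit u)).orbitMap_eq.2 ⟨⟨γ, ⟨γ, hγ, rfl⟩, ?_⟩, Subtype.ext hγ, rfl⟩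
  rw [hγ]
  exact mem_orbit_self u

theorem norm_restrictOrbitHom (u : X) (f : α.Ind) :
    ‖α.restrictOrbitHom u f‖ = ‖α.evalHom u f‖ := by
  refine le_antisymm (norm_ind_le (norm_nonneg _) fun v => ?_)
    (norm_ind_apply_le (α.restrictOrbitHom u f) ⟨u, mem_orbit_self u⟩)
  rw [← norm_ind_eq_of_orbitMap_eq _ (orbitMap_restrict_orbit u v)]
  rfl

variable [LocallyCompactSpace X] [T2Space X] [SecondCountableTopology X]

/-- The range is dense by `exists_ind_near`. Each value in it has a preimage of norm at most twice
its own, namely `f - φ f` with `ε = ‖f u‖` in the cut-off, so successive approximation reaches every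
`a`. -/
theorem evalHom_surjective (hp : G.IsPrincipal) (hG : G.IsProper) (hr : IsOpenMap G.r) (u : X) :
    Function.Surjective (α.evalHom u) := by
  have := hG.t2Space hr
  have := TopologicalGroupoid.locallyCompactSpace_orbitSpace hr
  let ev : NormedAddGroupHom α.Ind (A u) :=
    AddMonoidHom.mkNormedAddGroupHom (α.evalHom u : α.Ind →+ A u) 1 fun f => by
      rw [one_mul]
      exact norm_ind_apply_le f u
  have hev : ∀ f, ev f = (f : lp A ∞) u := fun f => rfl
  have h1 : ev.SurjectiveOnWith ev.range 2 := by
    rintro _ ⟨f, rfl⟩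
    by_cases hf : (f : lp A ∞) u = 0
    · exact ⟨0, (map_zero ev).trans hf.symm, by simp⟩
    · obtain ⟨φ, hφ, h⟩ := exists_c₀Smul_sub_near u f (norm_pos_iff.2 hf)
      refine ⟨f - c₀SmulL φ f, ?_, ?_⟩
      · have : ev (c₀SmulL φ f) = 0 := by
          rw [hev, c₀SmulL_apply, hφ, zero_smul]
        rw [map_sub, this, sub_zero]
        rfl
      · rw [norm_sub_rev]
        refine h.trans (le_of_eq ?_)
        rw [two_mul]
        rfl
  intro a
  have ha : a ∈ ev.range.topologicalClosure := by
    refine Metric.mem_closure_iff.2 fun ε hε => ?_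
    obtain ⟨f, hf⟩ := α.exists_ind_near hp hG hr u a (half_pos hε)
    refine ⟨ev f, ⟨f, rfl⟩, ?_⟩
    rw [dist_comm, dist_eq_norm, hev]
    linarith
  obtain ⟨f, hf, -⟩ := controlled_closure_of_complete two_pos one_pos h1 a ha
  exact ⟨f, hf⟩

/-- For `≤`, the representative `f - φ f` has norm at most `‖f u‖ + ε`. For `≥`, every
representative takes the value `f u` at `u`, because elements of the ideal vanish there. -/
theorem norm_toFibre_ind (hG : G.IsProper) (hr : IsOpenMap G.r)
    (hsep : TopologicalSpace.IsSeparable B.sections₀) (u : X) (f : α.Ind) :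
    ‖(indC0Algebra α hG hr hsep).toFibre (G.orbitMap u) f‖ = ‖α.evalHom u f‖ := by
  have := hG.t2Space hr
  have := TopologicalGroupoid.locallyCompactSpace_orbitSpace hr
  set Θ := indC0Algebra α hG hr hsep
  have h0 : ∀ f ∈ Θ.fibreIdeal (G.orbitMap u), α.evalHom u f = 0 := by
    intro f hf
    have hc : IsClosed {f : α.Ind | α.evalHom u f = 0} :=
      isClosed_eq (AddMonoidHomClass.continuous_of_bound (α.evalHom u) 1 fun f => by
        rw [one_mul]
        exact norm_ind_apply_le f u) continuous_const
    refine closure_minimal (fun g hg => ?_) hc hf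
    refine Submodule.span_induction (p := fun g _ => α.evalHom u g = 0) ?_ (map_zero _) ?_ ?_ hg
    · rintro _ ⟨φ, b, hφ, rfl⟩
      change φ (G.orbitMap u) • (b : lp A ∞) u = 0
      rw [hφ, zero_smul]
    · intro x y _ _ hx hy
      rw [map_add, hx, hy, add_zero]
    · intro k x _ hx
      rw [map_smul, hx, smul_zero]
  refine le_antisymm (le_of_forall_pos_le_add fun ε hε => ?_)
    (le_of_forall_pos_le_add fun ε hε => ?_)
  · obtain ⟨φ, hφ, h⟩ := exists_c₀Smul_sub_near u f hε
    have e : Θ.toFibre (G.orbitMap u) f = Θ.toFibre (G.orbitMap u) (f - c₀SmulL φ f) := by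
      rw [Θ.toFibre_eq_iff, sub_sub_cancel]
      exact Submodule.le_topologicalClosure _ (Submodule.subset_span ⟨φ, f, hφ, rfl⟩)
    rw [e]
    refine (Θ.norm_toFibre_le _ _).trans ?_
    rwa [norm_sub_rev]
  · obtain ⟨g, hg, hgn⟩ := Θ.exists_norm_lt (G.orbitMap u) f hε
    have h := h0 _ ((Θ.toFibre_eq_iff _ _ _).1 hg)
    rw [map_sub, sub_eq_zero] at h
    rw [← h]
    exact (norm_ind_apply_le g u).trans hgn.le

/-- Some `f` agrees with `g` at `u`; the difference of its restriction and `g` is equivariant, so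
its norm is constant on the orbit and hence zero. -/
theorem restrictOrbitHom_surjective (hp : G.IsPrincipal) (hG : G.IsProper) (hr : IsOpenMap G.r)
    (u : X) : Function.Surjective (α.restrictOrbitHom u) := by
  intro g
  obtain ⟨f, hf⟩ := α.evalHom_surjective hp hG hr u
    ((g : lp (fun v : G.orbit u => A v) ∞) ⟨u, mem_orbit_self u⟩)
  refine ⟨f, sub_eq_zero.1 (norm_eq_zero.1 (le_antisymm (norm_ind_le le_rfl fun v => ?_)
    (norm_nonneg _)))⟩
  rw [← norm_ind_eq_of_orbitMap_eq _ (orbitMap_restrict_orbit u v)]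
  refine le_of_eq (norm_eq_zero.2 ?_)
  exact sub_eq_zero.2 hf

end GroupoidAction

/-! ### Restriction of the groupoid and its Haar system to a closed invariant set -/

theorem MeasurableEmbedding.integral_comap_eq {Y Z : Type*} [MeasurableSpace Y] [MeasurableSpace Z]
    {i : Y → Z} (hi : MeasurableEmbedding i) {μ : Measure Z} (hμ : ∀ᵐ z ∂μ, z ∈ range i)
    (h : Z → ℂ) : ∫ y, h (i y) ∂(μ.comap i) = ∫ z, h z ∂μ := by
  rw [← hi.integral_map, hi.map_comap, Measure.restrict_eq_self_of_ae_mem hμ]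

/-- A compactly supported continuous function on a closed subspace extends to a compactly supported
continuous function. -/
theorem Topology.IsClosedEmbedding.exists_extension_hasCompactSupport {Y Z : Type*}
    [TopologicalSpace Y] [TopologicalSpace Z] [LocallyCompactSpace Z] [T2Space Z] [NormalSpace Z]
    {i : Y → Z} (hi : IsClosedEmbedding i) {f : Y → ℂ} (hf : Continuous f)
    (hfc : HasCompactSupport f) :
    ∃ g : Z → ℂ, Continuous g ∧ HasCompactSupport g ∧ ∀ y, g (i y) = f y := by
  obtain ⟨g, hg⟩ := ContinuousMap.exists_extension hi ⟨f, hf⟩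
  obtain ⟨χ, hχ1, -, hχ, -⟩ := exists_continuous_one_zero_of_isCompact
    (hfc.isCompact.image hi.continuous) (isClosed_empty (X := Z)) (disjoint_empty _)
  refine ⟨fun z => ((χ z : ℝ) : ℂ) * g z,
    (Complex.continuous_ofReal.comp χ.continuous).mul g.continuous,
    (hχ.comp_left (g := fun x : ℝ => (x : ℂ)) Complex.ofReal_zero).mul_right, fun y => ?_⟩
  have hgy : g (i y) = f y := congrArg (fun k : C(Y, ℂ) => k y) hg
  simp only [hgy]
  by_cases hy : y ∈ tsupport f
  · rw [hχ1 ⟨y, hy, rfl⟩]; simp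
  · simp [image_eq_zero_of_notMem_tsupport hy]

namespace TopologicalGroupoid

variable {E X : Type*} [TopologicalSpace E] [TopologicalSpace X] {G : TopologicalGroupoid E X}

theorem isClosedEmbedding_restrict {D : Set X} (hD : IsClosed D) :
    IsClosedEmbedding (Subtype.val : {γ : E // G.r γ ∈ D ∧ G.s γ ∈ D} → E) :=
  ((hD.preimage G.continuous_r).inter (hD.preimage G.continuous_s)).isClosedEmbedding_subtypeVal

theorem isClosed_orbit [T1Space G.OrbitSpace] (u : X) : IsClosed (G.orbit u) := by
  convert (isClosed_singleton (x := G.orbitMap u)).preimage G.isQuotientMap_orbitMap.continuous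
    using 1
  ext v
  exact (G.orbitMap_eq.symm).trans eq_comm

theorem orbit_invariant (u : X) (γ : E) (h : G.r γ ∈ G.orbit u) : G.s γ ∈ G.orbit u := by
  obtain ⟨η, hη, h⟩ := h
  exact ⟨G.mul (G.inv γ) η ((G.s_inv γ).trans h.symm), (G.s_mul _ _ _).trans hη,
    (G.r_mul _ _ _).trans (G.r_inv γ)⟩

theorem IsPrincipal.restrict (hG : G.IsPrincipal) (D : Set X) : (G.restrict D).IsPrincipal :=
  fun γ h => Subtype.ext (hG γ.1 (congrArg Subtype.val h))

theorem IsProper.restrict (hG : G.IsProper) {D : Set X} (hD : IsClosed D) :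
    (G.restrict D).IsProper := by
  intro K L hK hL
  convert (G.isClosedEmbedding_restrict hD).isCompact_preimage
    (hG _ _ (hK.image continuous_subtype_val) (hL.image continuous_subtype_val)) using 1
  ext γ
  constructor
  · exact fun h => ⟨⟨_, h.1, rfl⟩, ⟨_, h.2, rfl⟩⟩
  · rintro ⟨⟨x, hx, h1⟩, ⟨y, hy, h2⟩⟩
    exact ⟨(Subtype.ext h1 : x = (G.restrict D).s γ) ▸ hx,
      (Subtype.ext h2 : y = (G.restrict D).r γ) ▸ hy⟩

variable [LocallyCompactSpace E] [T2Space E] [SecondCountableTopology E] [MeasurableSpace E]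
  [BorelSpace E]

/-- The restriction of a Haar system to a closed invariant set of units. -/
def HaarSystem.restrict [T2Space X] (lam : G.HaarSystem) {D : Set X} (hD : IsClosed D)
    (hinv : ∀ γ, G.r γ ∈ D → G.s γ ∈ D) : (G.restrict D).HaarSystem := by
  have hi := G.isClosedEmbedding_restrict hD
  have hm := hi.measurableEmbedding
  -- Invariance enters here: an arrow with range in `D` has source in `D`, so `μ v` loses no mass
  -- when restricted.
  have hae : ∀ v : D, ∀ᵐ γ ∂(lam.μ v), γ ∈ range
      (Subtype.val : {γ : E // G.r γ ∈ D ∧ G.s γ ∈ D} → E) := fun v => by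
    filter_upwards [ae_r_eq lam v.1] with γ hγ
    have h : G.r γ ∈ D := by rw [hγ]; exact v.2
    exact ⟨⟨γ, h, hinv γ h⟩, rfl⟩
  refine
    { μ := fun v => (lam.μ v).comap Subtype.val
      finite_on_compacts := fun v => ⟨fun K hK => ?_⟩
      support_eq := fun v => ?_
      continuous_integral := fun f hf hfc => ?_
      left_invariant := fun η f hf hfc => ?_ }
  · have := lam.finite_on_compacts
    rw [hm.comap_apply]
    exact (hK.image continuous_subtype_val).measure_lt_top
  · have e : ∀ γ : {γ : E // G.r γ ∈ D ∧ G.s γ ∈ D},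
        γ ∈ ((lam.μ v).comap Subtype.val).support ↔ γ.1 ∈ (lam.μ v).support := fun γ => by
      rw [((𝓝 γ.1).basis_sets).mem_measureSupport,
        (hi.isInducing.basis_nhds (𝓝 γ.1).basis_sets).mem_measureSupport]
      refine forall₂_congr fun U _ => ?_
      rw [hm.comap_apply, Function.comp_apply, id, image_preimage_eq_inter_range,
        ← Measure.restrict_apply' hm.measurableSet_range,
        Measure.restrict_eq_self_of_ae_mem (hae v)]
    ext γ
    rw [e, lam.support_eq]
    exact (Subtype.ext_iff (a1 := (G.restrict D).r γ) (a2 := v)).symm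
  · obtain ⟨g, hg, hgc, hgf⟩ := hi.exists_extension_hasCompactSupport hf hfc
    have h := (lam.continuous_integral g hg hgc).comp (continuous_subtype_val (p := (· ∈ D)))
    refine h.congr fun v => ?_
    rw [Function.comp_apply, ← hm.integral_comap_eq (hae v)]
    simp only [hgf]
  · classical
    obtain ⟨g, hg, hgc, hgf⟩ := hi.exists_extension_hasCompactSupport hf hfc
    -- The translate of `g`, extended by zero. The left-hand integrals of both invariance identities
    -- equal its integral against `μ (s η)`, as that measure is concentrated on composable arrows.
    let h : E → ℂ := fun γ => if hγ : G.s η.1 = G.r γ then g (G.mul η.1 γ hγ) else 0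
    have h1 := lam.left_invariant η.1 g hg hgc
    have hc1 : IsClosedEmbedding (Subtype.val : {γ : E // G.s η.1 = G.r γ} → E) :=
      (isClosed_eq continuous_const G.continuous_r).isClosedEmbedding_subtypeVal
    have hc2 : IsClosedEmbedding (Subtype.val :
        {γ : {γ : E // G.r γ ∈ D ∧ G.s γ ∈ D} // (G.restrict D).s η = (G.restrict D).r γ} → _) :=
      (isClosed_eq continuous_const (G.restrict D).continuous_r).isClosedEmbedding_subtypeVal
    have a1 : ∀ᵐ γ ∂(lam.μ (G.s η.1)), γ ∈ range
        (Subtype.val : {γ : E // G.s η.1 = G.r γ} → E) := by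
      filter_upwards [ae_r_eq lam (G.s η.1)] with γ hγ
      exact ⟨⟨γ, hγ.symm⟩, rfl⟩
    have a2 : ∀ᵐ γ ∂((lam.μ (G.s η.1)).comap
        (Subtype.val : {γ : E // G.r γ ∈ D ∧ G.s γ ∈ D} → E)), γ ∈ range (Subtype.val :
        {γ : {γ : E // G.r γ ∈ D ∧ G.s γ ∈ D} //
          (G.restrict D).s η = (G.restrict D).r γ} → _) := by
      rw [ae_iff, hm.comap_apply]
      refine measure_mono_null ?_ (ae_iff.1 (ae_r_eq lam (G.s η.1)))
      rintro _ ⟨γ, hγ, rfl⟩ h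
      exact hγ ⟨⟨γ, Subtype.ext h.symm⟩, rfl⟩
    have e1 := hc1.measurableEmbedding.integral_comap_eq a1 h
    have e2 := hc2.measurableEmbedding.integral_comap_eq a2 fun γ => h γ.1
    have e3 := hm.integral_comap_eq (hae ⟨G.s η.1, η.2.2⟩) h
    have e4 := hm.integral_comap_eq (hae ⟨G.r η.1, η.2.1⟩) g
    have f1 : ∀ γ : {γ : E // G.s η.1 = G.r γ}, h γ.1 = g (G.mul η.1 γ.1 γ.2) := fun γ =>
      dif_pos γ.2
    have f2 : ∀ γ : {γ : {γ : E // G.r γ ∈ D ∧ G.s γ ∈ D} //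
        (G.restrict D).s η = (G.restrict D).r γ},
        h γ.1.1 = f ((G.restrict D).mul η γ.1 γ.2) := fun γ => by
      rw [← hgf]
      exact dif_pos (congrArg Subtype.val γ.2)
    simp only [f1] at e1
    simp only [f2] at e2
    simp only [hgf] at e4
    exact e2.trans (e3.trans (e1.symm.trans (h1.trans e4.symm)))

end TopologicalGroupoid

end

/-! ### The main theorem -/

theorem proposition3p3 {E X : Type*} [TopologicalSpace E] [TopologicalSpace X]
    [LocallyCompactSpace E] [T2Space E] [SecondCountableTopology E]
    [LocallyCompactSpace X] [T2Space X] [SecondCountableTopology X]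
    [MeasurableSpace E] [BorelSpace E]
    (G : TopologicalGroupoid E X) (hprincipal : G.IsPrincipal) (hproper : G.IsProper)
    (lam : G.HaarSystem)
    {A : X → Type*} [∀ x, NonUnitalCStarAlgebra (A x)] (B : USCBundle A)
    (hsep : TopologicalSpace.IsSeparable B.sections₀)
    (α : GroupoidAction G B) :
    ∃ Θ : C0Algebra G.OrbitSpace α.Ind,
      (∀ (φ : C₀(G.OrbitSpace, ℂ)) (f : α.Ind) (u : X),
        ((Θ.toHom φ).fst f : lp A ∞) u = φ (G.orbitMap u) • (f : lp A ∞) u ∧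
        ((Θ.toHom φ).snd f : lp A ∞) u = φ (G.orbitMap u) • (f : lp A ∞) u) ∧
      ∀ u : X,
        (LocallyCompactSpace {γ : E // G.r γ ∈ G.orbit u ∧ G.s γ ∈ G.orbit u} ∧
          LocallyCompactSpace (G.orbit u) ∧
          (G.restrict (G.orbit u)).IsPrincipal ∧ (G.restrict (G.orbit u)).IsProper ∧
          Nonempty (G.restrict (G.orbit u)).HaarSystem) ∧
        (∃ R : Θ.Fibre (G.orbitMap u) ≃⋆ₐ[ℂ] (α.restrict (G.orbit u)).Ind,
          (∀ x, ‖R x‖ = ‖x‖) ∧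
          ∀ (f : α.Ind) (v : G.orbit u),
            (R (Θ.toFibre (G.orbitMap u) f) : lp (fun v : G.orbit u => A v) ∞) v =
              (f : lp A ∞) v) ∧
        (∃ e : Θ.Fibre (G.orbitMap u) ≃⋆ₐ[ℂ] A u,
          (∀ x, ‖e x‖ = ‖x‖) ∧
          ∀ f : α.Ind, e (Θ.toFibre (G.orbitMap u) f) = (f : lp A ∞) u) := by
  have hr := TopologicalGroupoid.isOpenMap_r lam
  have := hproper.t2Space hr
  refine ⟨α.indC0Algebra hproper hr hsep, fun φ f u => ⟨rfl, rfl⟩, fun u => ?_⟩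
  have hD : IsClosed (G.orbit u) := TopologicalGroupoid.isClosed_orbit u
  refine ⟨⟨(G.isClosedEmbedding_restrict hD).locallyCompactSpace,
    hD.isClosedEmbedding_subtypeVal.locallyCompactSpace, hprincipal.restrict _,
    hproper.restrict hD, ⟨lam.restrict hD (TopologicalGroupoid.orbit_invariant u)⟩⟩, ?_, ?_⟩
  · obtain ⟨R, hR, h⟩ := (α.indC0Algebra hproper hr hsep).exists_fibre_equiv (G.orbitMap u)
      (α.restrictOrbitHom u) (GroupoidAction.restrictOrbitHom_surjective hprincipal hproper hr u)
      fun f => by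
        rw [GroupoidAction.norm_toFibre_ind, GroupoidAction.norm_restrictOrbitHom]
    exact ⟨R, hR, fun f v => by rw [h]; rfl⟩
  · exact (α.indC0Algebra hproper hr hsep).exists_fibre_equiv (G.orbitMap u) (α.evalHom u)
      (GroupoidAction.evalHom_surjective hprincipal hproper hr u)
      (GroupoidAction.norm_toFibre_ind hproper hr hsep u)
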